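/- Let $\mathcal H$ be a separable complex Hilbert space, $d\ge 1$, and let $\mathcal F=\mathcal H\otimes\mathcal F_{\mathrm b}(L^2(\mathbb R^d))$, where for a $\sigma$-finite measure space $X$ the boson Fock space is $\mathcal F_{\mathrm b}(L^2(X))=\bigoplus_{n=0}^\infty\otimes_{\mathrm s}^nL^2(X)$ ($\otimes_{\mathrm s}^0L^2(X)=\mathbb C$). For an operator $T$ on $L^2(X)$ its second quantization is $d\Gamma_X(T)=\bigoplus_{n=0}^\infty T^{(n)}$, where $T^{(0)}=0$ and $T^{(n)}$ is the closure of $\sum_{j=1}^n I\otimes\cdots\otimes T\otimes\cdots\otimes I$ ($T$ in the $j$-th place) on $\otimes^n_{\mathrm s}L^2(X)$. Let $1$ denote multiplication by the constant function $1$, and let $N=I\otimes d\Gamma_{\mathbb R^d}(1)$ on $\mathcal F$. For $\varepsilon>0$ put $\mathbb R^d_{<\varepsilon}=\{k:|k|<\varepsilon\}$, $\mathbb R^d_{>\varepsilon}=\{k:|k|>\varepsilon\}$, and let $$U_\varepsilon:\mathcal F\to\mathcal H\otimes\mathcal F_{\mathrm b}(L^2(\mathbb R^d_{<\varepsilon}))\otimes\mathcal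 F_{\mathrm b}(L^2(\mathbb R^d_{>\varepsilon}))$$ be the canonical unitary operator, which sends $x\otimes a^\dagger(f_1)\cdots a^\dagger(f_m)a^\dagger(g_1)\cdots a^\dagger(g_n)\Omega$ to $x\otimes a^\dagger(f_1)\cdots a^\dagger(f_m)\Omega\otimes a^\dagger(g_1)\cdots a^\dagger(g_n)\Omega$ for $x\in\mathcal H$, $f_i\in L^2(\mathbb R^d_{<\varepsilon})$, $g_j\in L^2(\mathbb R^d_{>\varepsilon})$, where $\Omega$ denotes the respective Fock vacuum and $a^\dagger$ the creation operators. Let $N_{>\varepsilon}=U_\varepsilon^*\,(I\otimes I\otimes d\Gamma_{\mathbb R^d_{>\varepsilon}}(1))\,U_\varepsilon$ on $\mathcal F$. Write $N^{1/2}$ and $N_{>\varepsilon}^{1/2}$ for the non-negative self-adjoint square roots and $D(\cdot)$ for domains, and set $$D_{\mathrm{CNB}}=\Big\{\Psi\in\bigcap_{\varepsilon>0}D(N_{>\varepsilon}^{1/2})\ \Big|\ \sup_{\varepsilon>0}\|N_{>\varepsilon}^{1/2}\Psi\|_{\mathcal F}^2<\infty\Big\}.$$ Then $D_{\mathrm{CNB}}=D(N^{1/2})$,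 and $$\sup_{\varepsilon>0}\|N_{>\varepsilon}^{1/2}\Psi\|_{\mathcal F}^2=\|N^{1/2}\Psi\|_{\mathcal F}^2\qquad\text{for every }\Psi\in D_{\mathrm{CNB}}.$$ -/

import Mathlib

open MeasureTheory
open scoped TensorProduct InnerProductSpace

noncomputable section

namespace FockNumber

/-! ## Tensor products of Hilbert spaces and unbounded operators -/

/-- The Hilbert space tensor product: the completion of the algebraic tensor product with respect
to the inner product `⟪x ⊗ y, x' ⊗ y'⟫ = ⟪x, x'⟫ * ⟪y, y'⟫`. -/
abbrev HilbertTensor (E F : Type*) [NormedAddCommGroup E] [InnerProductSpace ℂ E]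
    [NormedAddCommGroup F] [InnerProductSpace ℂ F] : Type _ :=
  UniformSpace.Completion (E ⊗[ℂ] F)

/-- The elementary tensor `x ⊗ y` in the Hilbert space tensor product. -/
def elemTensor {E F : Type*} [NormedAddCommGroup E] [InnerProductSpace ℂ E]
    [NormedAddCommGroup F] [InnerProductSpace ℂ F] (x : E) (y : F) : HilbertTensor E F :=
  ((x ⊗ₜ[ℂ] y : E ⊗[ℂ] F) : UniformSpace.Completion (E ⊗[ℂ] F))

/-- The closed operator `I ⊗ A` from `E ⊗ F` to `E ⊗ G` for an operator `A` from `F` to `G`: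
the closure of the operator `x ⊗ y ↦ x ⊗ A y` on the algebraic tensor product `E ⊗ D(A)`. -/
def idTensor (E : Type*) {F G : Type*} [NormedAddCommGroup E] [InnerProductSpace ℂ E]
    [NormedAddCommGroup F] [InnerProductSpace ℂ F] [NormedAddCommGroup G] [InnerProductSpace ℂ G]
    (A : F →ₗ.[ℂ] G) : HilbertTensor E F →ₗ.[ℂ] HilbertTensor E G :=
  (Submodule.span ℂ {p : HilbertTensor E F × HilbertTensor E G |
    ∃ (x : E) (y : A.domain), p = (elemTensor x (y : F), elemTensor x (A y))}
    ).topologicalClosure.toLinearPMap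

/-- `B` is a non-negative self-adjoint operator with `B² = A`, where `B²` is the operator product
with its natural domain `{x ∈ D(B) | B x ∈ D(B)}`. -/
def IsNonnegSqrt {E : Type*} [NormedAddCommGroup E] [InnerProductSpace ℂ E] [CompleteSpace E]
    (A B : E →ₗ.[ℂ] E) : Prop :=
  IsSelfAdjoint B ∧ (∀ x : B.domain, 0 ≤ (⟪(x : E), B x⟫_ℂ).re) ∧
    ∀ x z : E, (x, z) ∈ A.graph ↔ ∃ y : E, (x, y) ∈ B.graph ∧ (y, z) ∈ B.graph

/-- The square root `A^{1/2}` of a non-negative self-adjoint operator `A`: its unique non-negative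
self-adjoint square root. -/
def opSqrt {E : Type*} [NormedAddCommGroup E] [InnerProductSpace ℂ E] [CompleteSpace E]
    (A : E →ₗ.[ℂ] E) : E →ₗ.[ℂ] E :=
  Classical.epsilon (IsNonnegSqrt A)

/-- The operator `U* A U`, with domain `{x ∈ D(U) | U x ∈ D(A), A (U x) ∈ Ran U}` (which is
`{x | U x ∈ D(A)}` for unitary `U`). -/
def conjBy {E F : Type*} [NormedAddCommGroup E] [InnerProductSpace ℂ E]
    [NormedAddCommGroup F] [InnerProductSpace ℂ F] (U : E →ₗ.[ℂ] F) (A : F →ₗ.[ℂ] F) :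
    E →ₗ.[ℂ] E :=
  Submodule.toLinearPMap
    { carrier := {p | ∃ q ∈ A.graph, (p.1, q.1) ∈ U.graph ∧ (p.2, q.2) ∈ U.graph}
      zero_mem' := ⟨0, A.graph.zero_mem, U.graph.zero_mem, U.graph.zero_mem⟩
      add_mem' := by
        rintro p p' ⟨q, hq, h1, h2⟩ ⟨q', hq', h1', h2'⟩
        exact ⟨q + q', A.graph.add_mem hq hq', U.graph.add_mem h1 h1', U.graph.add_mem h2 h2'⟩
      smul_mem' := by
        rintro c p ⟨q, hq, h1, h2⟩
        exact ⟨c • q, A.graph.smul_mem c hq, U.graph.smul_mem c h1, U.graph.smul_mem c h2⟩ }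

/-! ## The boson Fock space over `L²(X, μ)` -/

section Fock

variable {X : Type*} [MeasurableSpace X]

/-- `L²(X, μ)`, complex-valued. -/
abbrev L2 (μ : Measure X) : Type _ := Lp ℂ 2 μ

/-- `L²(Xⁿ, μⁿ)`, i.e. the `n`-fold Hilbert space tensor power of `L²(X, μ)`.  For `n = 0` the
space `X⁰` is one point of mass one, so this is `ℂ`. -/
abbrev L2Pow (μ : Measure X) (n : ℕ) : Type _ := Lp ℂ 2 (Measure.pi fun _ : Fin n => μ)

variable (μ : Measure X) [SigmaFinite μ]

lemma measurePreserving_perm {n : ℕ} (σ : Equiv.Perm (Fin n)) :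
    MeasurePreserving (fun (x : Fin n → X) (i : Fin n) => x (σ i))
      (Measure.pi fun _ : Fin n => μ) (Measure.pi fun _ : Fin n => μ) := by
  have h := measurePreserving_piCongrLeft (fun _ : Fin n => μ) σ.symm
  convert h using 1
  ext x i
  have := MeasurableEquiv.piCongrLeft_apply_apply (β := fun _ : Fin n => X) σ.symm x (σ i)
  simpa using this.symm

/-- The action of permutations on `L²(Xⁿ)`: `(permute σ ψ)(k₁, …, kₙ) = ψ(k_{σ 1}, …, k_{σ n})`. -/
def permute {n : ℕ} (σ : Equiv.Perm (Fin n)) (ψ : L2Pow μ n) : L2Pow μ n :=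
  Lp.compMeasurePreserving _ (measurePreserving_perm μ σ) ψ

/-- The `n`-fold symmetric tensor product of `L²(X, μ)`, as the space of permutation invariant
elements of `L²(Xⁿ, μⁿ)`. -/
def symPow (n : ℕ) : Submodule ℂ (L2Pow μ n) where
  carrier := {ψ | ∀ σ : Equiv.Perm (Fin n), permute μ σ ψ = ψ}
  zero_mem' := fun σ => map_zero _
  add_mem' := by
    intro ψ φ hψ hφ σ
    exact (map_add _ ψ φ).trans (congrArg₂ (· + ·) (hψ σ) (hφ σ))
  smul_mem' := by
    intro c ψ hψ σ
    exact (map_smul (Lp.compMeasurePreservingₗ ℂ _ (measurePreserving_perm μ σ)) c ψ).trans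
      (congrArg (c • ·) (hψ σ))

variable {μ}

lemma memLp_tensor {n : ℕ} (f : Fin n → L2 μ) :
    MemLp (fun x : Fin n → X => ∏ i, f i (x i)) 2 (Measure.pi fun _ : Fin n => μ) := by
  have hm : AEStronglyMeasurable (fun x : Fin n → X => ∏ i, f i (x i))
      (Measure.pi fun _ : Fin n => μ) := by
    refine Finset.aestronglyMeasurable_fun_prod _ fun i _ => ?_
    exact (Lp.aestronglyMeasurable (f i)).comp_quasiMeasurePreserving
      (Measure.quasiMeasurePreserving_eval _ i)
  rw [memLp_two_iff_integrable_sq_norm hm]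
  have h : Integrable (fun x : Fin n → X => ∏ i, ‖f i (x i)‖ ^ 2)
      (Measure.pi fun _ : Fin n => μ) :=
    Integrable.fintype_prod (f := fun i x => ‖f i x‖ ^ 2)
      fun i => (memLp_two_iff_integrable_sq_norm (Lp.aestronglyMeasurable (f i))).1 (Lp.memLp (f i))
  simpa only [norm_prod, Finset.prod_pow] using h

/-- The tensor `f₁ ⊗ ⋯ ⊗ fₙ`, i.e. the function `(k₁, …, kₙ) ↦ f₁(k₁) ⋯ fₙ(kₙ)`. -/
def tensor {n : ℕ} (f : Fin n → L2 μ) : L2Pow μ n :=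
  (memLp_tensor f).toLp _

lemma permute_tensor {n : ℕ} (σ : Equiv.Perm (Fin n)) (f : Fin n → L2 μ) :
    permute μ σ (tensor f) = tensor fun i => f (σ.symm i) := by
  unfold permute tensor
  rw [Lp.toLp_compMeasurePreserving]
  congr 1
  funext x
  exact Fintype.prod_equiv σ _ _ fun i => by simp

/-- The symmetric tensor `√(n!) Sₙ(f₁ ⊗ ⋯ ⊗ fₙ)`, where `Sₙ` is the symmetrization projection
`(1 / n!) ∑_σ σ`.  In Fock space this is the vector `a†(f₁) ⋯ a†(fₙ) Ω`. -/
def symTensor {n : ℕ} (f : Fin n → L2 μ) : symPow μ n :=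
  ⟨((Real.sqrt (n.factorial : ℝ) : ℂ)⁻¹) • ∑ τ : Equiv.Perm (Fin n), tensor fun i => f (τ i), by
    intro σ
    have hs : ∀ ψ : L2Pow μ n, permute μ σ ψ =
      Lp.compMeasurePreservingₗ ℂ _ (measurePreserving_perm μ σ) ψ := fun _ => rfl
    rw [hs, map_smul, map_sum]
    simp only [← hs, permute_tensor]
    congr 1
    exact Fintype.sum_equiv (Equiv.mulRight σ.symm) _ _ fun τ => rfl⟩

variable (μ) in
/-- The boson Fock space over `L²(X, μ)`: the Hilbert space direct sum of the symmetric tensor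
powers. -/
abbrev Fock : Type _ := lp (fun n : ℕ => symPow μ n) 2

/-- The vector of the Fock space whose only component is `symTensor f`, in the `n`-particle space;
for `n = 0` it is the Fock vacuum. -/
def fockVec {n : ℕ} (f : Fin n → L2 μ) : Fock μ :=
  lp.single 2 n (symTensor f)

/-- The operator `T⁽ⁿ⁾` on the `n`-fold symmetric tensor product: the closure of
`∑ⱼ I ⊗ ⋯ ⊗ T ⊗ ⋯ ⊗ I` (with `T` in the `j`-th place).  For `n = 0` it is `0`. -/
def dGammaN (T : L2 μ →ₗ.[ℂ] L2 μ) (n : ℕ) : symPow μ n →ₗ.[ℂ] symPow μ n :=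
  (Submodule.span ℂ {p : symPow μ n × symPow μ n | ∃ f : Fin n → T.domain,
    p = (symTensor fun i => (f i : L2 μ),
      ∑ j, symTensor (Function.update (fun i => (f i : L2 μ)) j (T (f j))))}
    ).topologicalClosure.toLinearPMap

/-- The second quantization `dΓ(T) = ⨁ₙ T⁽ⁿ⁾`: its domain consists of all `ψ` such that
`ψ⁽ⁿ⁾ ∈ D(T⁽ⁿ⁾)` for all `n` and `∑ₙ ‖T⁽ⁿ⁾ ψ⁽ⁿ⁾‖² < ∞`. -/
def dGamma (T : L2 μ →ₗ.[ℂ] L2 μ) : Fock μ →ₗ.[ℂ] Fock μ :=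
  Submodule.toLinearPMap
    { carrier := {p | ∀ n, (p.1 n, p.2 n) ∈ (dGammaN T n).graph}
      zero_mem' := fun n => (dGammaN T n).graph.zero_mem
      add_mem' := fun h h' n => (dGammaN T n).graph.add_mem (h n) (h' n)
      smul_mem' := fun c _ h n => (dGammaN T n).graph.smul_mem c (h n) }

variable (μ) in
/-- The operator of multiplication by the constant function `1` on `L²(X, μ)`. -/
def mulOne : L2 μ →ₗ.[ℂ] L2 μ := (LinearMap.id : L2 μ →ₗ[ℂ] L2 μ).toPMap ⊤

variable (μ) in
/-- The number operator `dΓ(1)` on the Fock space over `L²(X, μ)`. -/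
def fockNumber : Fock μ →ₗ.[ℂ] Fock μ := dGamma (mulOne μ)

variable (μ) in
/-- For disjoint sets `s` and `t` whose union has full measure, the canonical unitary operator
from the Fock space over `L²(X)` onto the tensor product of the Fock spaces over `L²(s)` and
`L²(t)`.  It is the closed linear operator with
`a†(f₁) ⋯ a†(fₘ) a†(g₁) ⋯ a†(gₙ) Ω ↦ (a†(f₁) ⋯ a†(fₘ) Ω) ⊗ (a†(g₁) ⋯ a†(gₙ) Ω)`
for all `f₁, …, fₘ` vanishing a.e. outside `s` and all `g₁, …, gₙ` vanishing a.e. outside `t`. -/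
def fockSplit (s t : Set X) :
    Fock μ →ₗ.[ℂ] HilbertTensor (Fock (μ.restrict s)) (Fock (μ.restrict t)) :=
  (Submodule.span ℂ {p : Fock μ × HilbertTensor (Fock (μ.restrict s)) (Fock (μ.restrict t)) |
    ∃ (m n : ℕ) (f : Fin m → L2 μ) (g : Fin n → L2 μ),
      (∀ i, ∀ᵐ k ∂μ, k ∉ s → f i k = 0) ∧ (∀ j, ∀ᵐ k ∂μ, k ∉ t → g j k = 0) ∧
      p = (fockVec (Fin.append f g),
        elemTensor (fockVec fun i => LpToLpRestrictCLM X ℂ ℂ μ 2 s (f i))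
          (fockVec fun j => LpToLpRestrictCLM X ℂ ℂ μ 2 t (g j)))}
    ).topologicalClosure.toLinearPMap

end Fock

/-! ## Number operators on `𝓗 ⊗ 𝓕_b(L²(ℝᵈ))` -/

section Number

variable (H : Type*) [NormedAddCommGroup H] [InnerProductSpace ℂ H] (d : ℕ)

/-- Lebesgue measure on `ℝᵈ`. -/
abbrev leb : Measure (EuclideanSpace ℝ (Fin d)) := volume

/-- The set of `k` in `ℝᵈ` with `|k| < ε`. -/
def inner_set (ε : ℝ) : Set (EuclideanSpace ℝ (Fin d)) := {k | ‖k‖ < ε}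

/-- The set of `k` in `ℝᵈ` with `|k| > ε`. -/
def outer_set (ε : ℝ) : Set (EuclideanSpace ℝ (Fin d)) := {k | ε < ‖k‖}

/-- The total state space `𝓕 = 𝓗 ⊗ 𝓕_b(L²(ℝᵈ))`. -/
abbrev StateSpace : Type _ := HilbertTensor H (Fock (leb d))

/-- The space `𝓕_ε = 𝓗 ⊗ 𝓕_b(L²(|k| < ε)) ⊗ 𝓕_b(L²(|k| > ε))`. -/
abbrev SplitSpace (ε : ℝ) : Type _ :=
  HilbertTensor H (HilbertTensor (Fock ((leb d).restrict (inner_set d ε)))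
    (Fock ((leb d).restrict (outer_set d ε))))

/-- The canonical unitary operator `U_ε : 𝓕 → 𝓕_ε`. -/
def splitOp (ε : ℝ) : StateSpace H d →ₗ.[ℂ] SplitSpace H d ε :=
  idTensor H (fockSplit (leb d) (inner_set d ε) (outer_set d ε))

/-- The boson number operator `N = I ⊗ dΓ(1)` on `𝓕`. -/
def number : StateSpace H d →ₗ.[ℂ] StateSpace H d :=
  idTensor H (fockNumber (leb d))

/-- The operator `N_{>ε} = U_ε* (I ⊗ I ⊗ dΓ_{>ε}(1)) U_ε` on `𝓕`. -/
def numberGT (ε : ℝ) : StateSpace H d →ₗ.[ℂ] StateSpace H d :=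
  conjBy (splitOp H d ε)
    (idTensor H (idTensor (Fock ((leb d).restrict (inner_set d ε)))
      (fockNumber ((leb d).restrict (outer_set d ε)))))

/-- `D_CNB`: the vectors `Ψ` in `⋂_{ε > 0} D(N_{>ε}^{1/2})` such that
`sup_{ε > 0} ‖N_{>ε}^{1/2} Ψ‖² < ∞`. -/
def domainCNB : Set (StateSpace H d) :=
  {Ψ | ∃ h : ∀ ε : ℝ, 0 < ε → Ψ ∈ (opSqrt (numberGT H d ε)).domain,
    BddAbove (Set.range fun ε : Set.Ioi (0 : ℝ) =>
      ‖opSqrt (numberGT H d ε) ⟨Ψ, h ε ε.2⟩‖ ^ 2)}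

end Number

end FockNumber

end

/-!
Call an operator diagonal if it multiplies each summand of an orthogonal decomposition by a real
number, with maximal domain. A closed symmetric operator acting in this way on a spanning set of
each summand is the diagonal one, so closures, tensor factors `I ⊗ A`, unitary conjugates and the
square root of a diagonal operator are again diagonal, and the square root satisfies
`‖A^{1/2} Ψ‖² = ∑ᵢ aᵢ ‖Pᵢ Ψ‖²`, with value `∞` exactly outside its domain.

For fixed `ε`, the vectors `x ⊗ a†(f₁) ⋯ a†(fₖ) a†(g₁) ⋯ a†(gₘ) Ω`, with `fᵢ` vanishing off the ball
`|k| < ε` and `gⱼ` off its exterior, span an orthogonal decomposition indexed by `(k, m)`: the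
missing sphere is a null set. There `N` is `k + m` and `N_{>ε}` is `m`, whence
`‖N_{>ε}^{1/2} Ψ‖ ≤ ‖N^{1/2} Ψ‖`. Conversely the summands `(0, n)` increase as `ε` decreases and
exhaust the `n`-particle space, because `{0}` is a null set. So their projections converge strongly
to the `n`-particle projection, and every partial sum of `‖N^{1/2} Ψ‖² = ∑ₙ n ‖Pₙ Ψ‖²` is a limit
of sums bounded by `‖N_{>ε}^{1/2} Ψ‖²`.
-/

noncomputable section

namespace FockNumber

open Submodule Filter Topology

section OrthogonalDecomposition

variable {ι E : Type*} [NormedAddCommGroup E] [InnerProductSpace ℂ E] {S : ι → Set E}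

/-- An orthogonal decomposition of a Hilbert space, presented by a set `S i` of vectors spanning a
dense subspace of the `i`-th summand. -/
structure IsOrthogonalDecomposition (S : ι → Set E) : Prop where
  inner_eq_zero : ∀ ⦃i j⦄, i ≠ j → ∀ v ∈ S i, ∀ w ∈ S j, ⟪v, w⟫_ℂ = 0
  dense_span : Dense (span ℂ (⋃ i, S i) : Set E)

lemma mem_orthogonal_span_iff {s : Set E} {x : E} :
    x ∈ (span ℂ s)ᗮ ↔ ∀ v ∈ s, ⟪v, x⟫_ℂ = 0 := by
  simp only [← span_singleton_le_iff_mem x, ← isOrtho_iff_le, isOrtho_comm (U := ℂ ∙ x),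
    isOrtho_span, Set.mem_singleton_iff, forall_eq]

/-- The `i`-th summand of the orthogonal decomposition presented by `S`. -/
abbrev summand (S : ι → Set E) (i : ι) : Submodule ℂ E := (span ℂ (S i)).topologicalClosure

lemma subset_summand (S : ι → Set E) (i : ι) : S i ⊆ summand S i :=
  subset_span.trans (le_topologicalClosure _)

lemma IsOrthogonalDecomposition.orthogonalFamily (hS : IsOrthogonalDecomposition S) :
    OrthogonalFamily ℂ (fun i => summand S i) fun i => (summand S i).subtypeₗᵢ :=
  OrthogonalFamily.of_pairwise fun i j hij => by
    rw [Function.onFun, isOrtho_iff_le, orthogonal_closure]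
    refine topologicalClosure_minimal _ ?_ (isClosed_orthogonal _)
    rw [← isOrtho_iff_le, isOrtho_span]
    exact fun v hv w hw => hS.inner_eq_zero hij v hv w hw

variable [CompleteSpace E]

/-- The orthogonal projection onto the `i`-th summand of the orthogonal decomposition presented
by `S`. -/
def component (S : ι → Set E) (i : ι) : E →L[ℂ] E := (summand S i).starProjection

lemma component_mem (S : ι → Set E) (i : ι) (x : E) : component S i x ∈ summand S i :=
  starProjection_apply_mem _ x

lemma component_eq_iff {i : ι} {x z : E} (hz : z ∈ summand S i) :
    component S i x = z ↔ ∀ v ∈ S i, ⟪v, x⟫_ℂ = ⟪v, z⟫_ℂ := by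
  have : component S i x = z ↔ x - z ∈ (span ℂ (S i))ᗮ := by
    rw [← orthogonal_closure]
    refine ⟨?_, eq_starProjection_of_mem_orthogonal hz⟩
    rintro rfl
    exact sub_starProjection_mem_orthogonal x
  simp only [this, mem_orthogonal_span_iff, inner_sub_right, sub_eq_zero]

lemma inner_component {i : ι} {v : E} (hv : v ∈ S i) (x : E) :
    ⟪v, component S i x⟫_ℂ = ⟪v, x⟫_ℂ :=
  ((component_eq_iff (component_mem S i x)).1 rfl v hv).symm

namespace IsOrthogonalDecomposition

lemma isHilbertSum (hS : IsOrthogonalDecomposition S) :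
    IsHilbertSum ℂ (fun i => summand S i) fun i => (summand S i).subtypeₗᵢ := by
  have (i : ι) : CompleteSpace (summand S i) := (isClosed_topologicalClosure _).completeSpace_coe
  refine IsHilbertSum.mkInternal _ hS.orthogonalFamily ?_
  rw [← dense_iff_topologicalClosure_eq_top.1 hS.dense_span, span_iUnion]
  exact topologicalClosure_mono (iSup_mono fun i => le_topologicalClosure _)

lemma coe_linearIsometryEquiv_apply (hS : IsOrthogonalDecomposition S) (x : E) (i : ι) :
    (hS.isHilbertSum.linearIsometryEquiv x i : E) = component S i x := by
  classical
  refine ((component_eq_iff (coe_mem _)).2 fun v hv => ?_).symm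
  let U := hS.isHilbertSum.linearIsometryEquiv
  let w : summand S i := ⟨v, subset_summand S i hv⟩
  calc ⟪v, x⟫_ℂ = ⟪U.symm (lp.single 2 i w), U.symm (U x)⟫_ℂ := by
        rw [hS.isHilbertSum.linearIsometryEquiv_symm_apply_single, U.symm_apply_apply]; rfl
    _ = ⟪w, U x i⟫_ℂ := by rw [U.symm.inner_map_map, lp.inner_single_left]

lemma hasSum_component (hS : IsOrthogonalDecomposition S) (x : E) :
    HasSum (fun i => component S i x) x := by
  simpa [hS.coe_linearIsometryEquiv_apply] using
    hS.isHilbertSum.hasSum_linearIsometryEquiv_symm (hS.isHilbertSum.linearIsometryEquiv x)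

lemma hasSum_inner_component (hS : IsOrthogonalDecomposition S) (x y : E) :
    HasSum (fun i => ⟪component S i x, component S i y⟫_ℂ) ⟪x, y⟫_ℂ := by
  simp only [← hS.coe_linearIsometryEquiv_apply, ← coe_inner]
  rw [← hS.isHilbertSum.linearIsometryEquiv.inner_map_map x y]
  exact lp.hasSum_inner _ _

lemma hasSum_norm_sq_component (hS : IsOrthogonalDecomposition S) (x : E) :
    HasSum (fun i => ‖component S i x‖ ^ 2) (‖x‖ ^ 2) := by
  have h := Complex.reCLM.hasSum (hS.hasSum_inner_component x x)
  simpa only [Complex.reCLM_apply, ← RCLike.re_eq_complex_re, inner_self_eq_norm_sq] using h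

lemma tsum_enorm_sq_component (hS : IsOrthogonalDecomposition S) (x : E) :
    ∑' i, ‖component S i x‖ₑ ^ 2 = ‖x‖ₑ ^ 2 := by
  have h := hS.hasSum_norm_sq_component x
  simp only [← ofReal_norm, ← ENNReal.ofReal_pow (norm_nonneg _), ← h.tsum_eq]
  exact (ENNReal.ofReal_tsum_of_nonneg (fun i => by positivity) h.summable).symm

lemma exists_component_eq (hS : IsOrthogonalDecomposition S) {z : ι → E}
    (hz : ∀ i, z i ∈ summand S i) (hs : Summable fun i => ‖z i‖ ^ 2) :
    ∃ x, ∀ i, component S i x = z i := by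
  have hmem : Memℓp (fun i => (⟨z i, hz i⟩ : summand S i)) 2 :=
    memℓp_gen (by simpa using hs)
  refine ⟨hS.isHilbertSum.linearIsometryEquiv.symm ⟨_, hmem⟩, fun i => ?_⟩
  rw [← hS.coe_linearIsometryEquiv_apply, LinearIsometryEquiv.apply_symm_apply]

end IsOrthogonalDecomposition

end OrthogonalDecomposition

section DiagonalOperator

variable {ι κ E : Type*} [NormedAddCommGroup E] [InnerProductSpace ℂ E] {S : ι → Set E}

/-- The graph of the operator that multiplies the `i`-th summand of the orthogonal decomposition
presented by `S` by the real number `a i`, with its maximal domain. -/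
def diagonalGraph (S : ι → Set E) (a : ι → ℝ) : Submodule ℂ (E × E) where
  carrier := {p | ∀ i, ∀ v ∈ S i, ⟪v, p.2⟫_ℂ = a i * ⟪v, p.1⟫_ℂ}
  zero_mem' i v _ := by simp
  add_mem' hp hq i v hv := by
    simp only [Prod.fst_add, Prod.snd_add, inner_add_right, hp i v hv, hq i v hv, mul_add]
  smul_mem' c p hp i v hv := by
    simp only [Prod.smul_fst, Prod.smul_snd, inner_smul_right, hp i v hv, mul_left_comm]

/-- The operator that multiplies the `i`-th summand of the orthogonal decomposition presented by
`S` by the real number `a i`, with its maximal domain. -/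
def diagonalOp (S : ι → Set E) (a : ι → ℝ) : E →ₗ.[ℂ] E := (diagonalGraph S a).toLinearPMap

lemma mem_diagonalGraph {a : ι → ℝ} {x y : E} :
    (x, y) ∈ diagonalGraph S a ↔ ∀ i, ∀ v ∈ S i, ⟪v, y⟫_ℂ = a i * ⟪v, x⟫_ℂ :=
  Iff.rfl

lemma isClosed_diagonalGraph (S : ι → Set E) (a : ι → ℝ) :
    IsClosed (diagonalGraph S a : Set (E × E)) := by
  have : (diagonalGraph S a : Set (E × E)) =
      ⋂ i, ⋂ v ∈ S i, {p : E × E | ⟪v, p.2⟫_ℂ = a i * ⟪v, p.1⟫_ℂ} := by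
    ext ⟨x, y⟩
    simp only [SetLike.mem_coe, mem_diagonalGraph, Set.mem_iInter, Set.mem_ofPred_eq]
  rw [this]
  exact isClosed_iInter fun i => isClosed_biInter fun v _ => isClosed_eq (by fun_prop) (by fun_prop)

lemma IsOrthogonalDecomposition.mk_smul_mem_diagonalGraph (hS : IsOrthogonalDecomposition S)
    (a : ι → ℝ) {i : ι} {v : E} (hv : v ∈ S i) : (v, (a i : ℂ) • v) ∈ diagonalGraph S a := by
  intro j w hw
  rw [inner_smul_right]
  by_cases hij : j = i
  · rw [hij]
  · rw [hS.inner_eq_zero hij w hw v hv, mul_zero, mul_zero]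

variable [CompleteSpace E]

lemma mem_diagonalGraph_iff_component {a : ι → ℝ} {x y : E} :
    (x, y) ∈ diagonalGraph S a ↔ ∀ i, component S i y = (a i : ℂ) • component S i x := by
  refine forall_congr' fun i => ?_
  rw [component_eq_iff (smul_mem _ _ (component_mem S i x))]
  refine forall₂_congr fun v hv => ?_
  rw [inner_smul_right, inner_component hv]

namespace IsOrthogonalDecomposition

lemma diagonalGraph_le (hS : IsOrthogonalDecomposition S) {a : ι → ℝ} {G : Submodule ℂ (E × E)}
    (hG : IsClosed (G : Set (E × E))) (h : ∀ i, ∀ v ∈ S i, (v, (a i : ℂ) • v) ∈ G) :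
    diagonalGraph S a ≤ G := by
  rintro ⟨x, y⟩ hxy
  have hsummand : ∀ i, ∀ z ∈ summand S i, (z, (a i : ℂ) • z) ∈ G := fun i => by
    let L : E →L[ℂ] E × E := (ContinuousLinearMap.id ℂ E).prod ((a i : ℂ) • .id ℂ E)
    exact topologicalClosure_minimal (t := G.comap L.toLinearMap) _ (span_le.2 (h i))
      (hG.preimage L.continuous)
  refine hG.mem_of_tendsto ((hS.hasSum_component x).prodMk (hS.hasSum_component y))
    (Eventually.of_forall fun s => G.sum_mem fun i _ => ?_)
  rw [mem_diagonalGraph_iff_component.1 hxy i]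
  exact hsummand i _ (component_mem S i x)

lemma graph_diagonalOp (hS : IsOrthogonalDecomposition S) (a : ι → ℝ) :
    (diagonalOp S a).graph = diagonalGraph S a := by
  refine toLinearPMap_graph_eq _ ?_
  rintro ⟨x, y⟩ hxy (rfl : x = 0)
  refine (hS.hasSum_component y).unique ?_
  simp only [mem_diagonalGraph_iff_component.1 hxy, map_zero, smul_zero, hasSum_zero]

lemma toLinearPMap_eq_diagonalOp (hS : IsOrthogonalDecomposition S) {a : ι → ℝ}
    {G : Submodule ℂ (E × E)} (hG : IsClosed (G : Set (E × E)))
    (h : ∀ i, ∀ v ∈ S i, (v, (a i : ℂ) • v) ∈ G) (hle : G ≤ diagonalGraph S a) :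
    G.toLinearPMap = diagonalOp S a := by
  rw [diagonalOp, le_antisymm hle (hS.diagonalGraph_le hG h)]

lemma diagonalOp_eq_of_subset (hS : IsOrthogonalDecomposition S) {T : κ → Set E}
    (hT : IsOrthogonalDecomposition T) {p : κ → ι} (h : ∀ k, T k ⊆ S (p k)) (a : ι → ℝ) :
    diagonalOp S a = diagonalOp T (a ∘ p) :=
  hT.toLinearPMap_eq_diagonalOp (isClosed_diagonalGraph S a)
    (fun k _ hv => hS.mk_smul_mem_diagonalGraph a (h k hv))
    fun _ hxy k v hv => hxy (p k) v (h k hv)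

lemma dense_domain_diagonalOp (hS : IsOrthogonalDecomposition S) (a : ι → ℝ) :
    Dense ((diagonalOp S a).domain : Set E) := by
  refine hS.dense_span.mono (span_le.2 (Set.iUnion_subset fun i v hv => ?_))
  rw [SetLike.mem_coe, LinearPMap.mem_domain_iff]
  exact ⟨_, hS.graph_diagonalOp a ▸ hS.mk_smul_mem_diagonalGraph a hv⟩

lemma isSelfAdjoint_diagonalOp (hS : IsOrthogonalDecomposition S) (a : ι → ℝ) :
    IsSelfAdjoint (diagonalOp S a) := by
  refine LinearPMap.isSelfAdjoint_def.2 (LinearPMap.eq_of_eq_graph ?_)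
  rw [LinearPMap.adjoint_graph_eq_graph_adjoint (hS.dense_domain_diagonalOp a),
    hS.graph_diagonalOp]
  ext ⟨x, y⟩
  rw [mem_adjoint_iff]
  constructor
  · intro h i v hv
    have := h _ _ (hS.mk_smul_mem_diagonalGraph a hv)
    rw [inner_smul_left, Complex.conj_ofReal, sub_eq_zero] at this
    exact this.symm
  · intro h u w huw
    rw [sub_eq_zero, ← (hS.hasSum_inner_component w x).tsum_eq,
      ← (hS.hasSum_inner_component u y).tsum_eq]
    refine tsum_congr fun i => ?_
    rw [mem_diagonalGraph_iff_component.1 h, mem_diagonalGraph_iff_component.1 huw,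
      inner_smul_left, inner_smul_right, Complex.conj_ofReal]

lemma re_inner_nonneg_of_mem_diagonalGraph (hS : IsOrthogonalDecomposition S) {a : ι → ℝ}
    (ha : ∀ i, 0 ≤ a i) {x y : E} (h : (x, y) ∈ diagonalGraph S a) : 0 ≤ (⟪x, y⟫_ℂ).re := by
  refine (Complex.reCLM.hasSum (hS.hasSum_inner_component x y)).nonneg fun i => ?_
  rw [mem_diagonalGraph_iff_component.1 h, inner_smul_right, Complex.reCLM_apply,
    Complex.re_ofReal_mul]
  exact mul_nonneg (ha i) (inner_self_nonneg (𝕜 := ℂ))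

lemma exists_mem_diagonalGraph_sqrt (hS : IsOrthogonalDecomposition S) {a : ι → ℝ}
    (ha : ∀ i, 0 ≤ a i) {x z : E} (h : (x, z) ∈ diagonalGraph S a) :
    ∃ y, (x, y) ∈ diagonalGraph S fun i => √(a i) := by
  have hle : ∀ i, ‖(√(a i) : ℂ) • component S i x‖ ^ 2 ≤
      ‖component S i x‖ ^ 2 + ‖component S i z‖ ^ 2 := fun i => by
    rw [mem_diagonalGraph_iff_component.1 h i, norm_smul, norm_smul, mul_pow, mul_pow,
      Complex.norm_real, Complex.norm_real, Real.norm_eq_abs, Real.norm_eq_abs, sq_abs, sq_abs,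
      Real.sq_sqrt (ha i)]
    nlinarith [sq_nonneg ‖component S i x‖, sq_nonneg (a i - 1), ha i]
  have hsum : Summable fun i => ‖(√(a i) : ℂ) • component S i x‖ ^ 2 :=
    Summable.of_nonneg_of_le (fun i => sq_nonneg _) hle
      ((hS.hasSum_norm_sq_component x).summable.add (hS.hasSum_norm_sq_component z).summable)
  obtain ⟨y, hy⟩ := hS.exists_component_eq (fun i => smul_mem _ _ (component_mem S i x)) hsum
  exact ⟨y, mem_diagonalGraph_iff_component.2 hy⟩

end IsOrthogonalDecomposition

end DiagonalOperator

section SquareRoot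

variable {ι E : Type*} [NormedAddCommGroup E] [InnerProductSpace ℂ E] [CompleteSpace E]
  {S : ι → Set E}

lemma inner_eq_inner_of_isSelfAdjoint {B : E →ₗ.[ℂ] E} (hB : IsSelfAdjoint B) {u v x y : E}
    (huv : (u, v) ∈ B.graph) (hxy : (x, y) ∈ B.graph) : ⟪v, x⟫_ℂ = ⟪u, y⟫_ℂ := by
  rw [← LinearPMap.isSelfAdjoint_def.1 hB, LinearPMap.adjoint_graph_eq_graph_adjoint
    hB.dense_domain, mem_adjoint_iff] at hxy
  exact sub_eq_zero.1 (hxy u v huv)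

/-- For `r > 0` the vector `w = y - r • u` satisfies `B w = -r • w`, which contradicts positivity
unless `w = 0`. -/
lemma eq_smul_of_isNonnegSqrt {A B : E →ₗ.[ℂ] E} (hB : IsNonnegSqrt A B) {r : ℝ} (hr : 0 ≤ r)
    {u y : E} (huy : (u, y) ∈ B.graph) (hyu : (y, ((r * r : ℝ) : ℂ) • u) ∈ B.graph) :
    y = (r : ℂ) • u := by
  obtain ⟨hsa, hnonneg, -⟩ := hB
  rcases hr.eq_or_lt with rfl | hpos
  · have : ⟪y, y⟫_ℂ = 0 := (inner_eq_inner_of_isSelfAdjoint hsa huy hyu).trans (by simp)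
    simpa using this
  · set w := y - (r : ℂ) • u with hw
    have hmem : (w, -(r : ℂ) • w) ∈ B.graph := by
      convert B.graph.sub_mem hyu (B.graph.smul_mem (r : ℂ) huy) using 1
      simp only [Prod.smul_mk, Prod.mk_sub_mk, hw, Complex.ofReal_mul, Prod.mk.injEq, true_and]
      module
    obtain ⟨w', hw', hBw⟩ := (LinearPMap.mem_graph_iff B).1 hmem
    have hle := hnonneg w'
    rw [hBw, hw', inner_smul_right, ← Complex.ofReal_neg, Complex.re_ofReal_mul,
      ← RCLike.re_eq_complex_re, inner_self_eq_norm_sq] at hle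
    have hw0 : ‖w‖ ^ 2 ≤ 0 := by nlinarith
    simpa [hw, sub_eq_zero] using hw0.antisymm (sq_nonneg _)

namespace IsOrthogonalDecomposition

lemma isNonnegSqrt_diagonalOp (hS : IsOrthogonalDecomposition S) {a : ι → ℝ}
    (ha : ∀ i, 0 ≤ a i) : IsNonnegSqrt (diagonalOp S a) (diagonalOp S fun i => √(a i)) := by
  refine ⟨hS.isSelfAdjoint_diagonalOp _, fun x => ?_, fun x z => ?_⟩
  · exact hS.re_inner_nonneg_of_mem_diagonalGraph (fun i => Real.sqrt_nonneg (a i))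
      (hS.graph_diagonalOp _ ▸ LinearPMap.mem_graph _ x)
  · have hsq : ∀ i, (√(a i) : ℂ) * (√(a i) : ℂ) = a i := fun i => by
      rw [← Complex.ofReal_mul, Real.mul_self_sqrt (ha i)]
    have hcomp : ∀ {y}, (x, y) ∈ diagonalGraph S (fun i => √(a i)) →
        ((y, z) ∈ diagonalGraph S (fun i => √(a i)) ↔ (x, z) ∈ diagonalGraph S a) := by
      intro y hxy
      refine forall_congr' fun i => forall₂_congr fun v hv => ?_
      rw [hxy i v hv, ← mul_assoc, hsq]
    rw [hS.graph_diagonalOp, hS.graph_diagonalOp]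
    constructor
    · intro h
      obtain ⟨y, hxy⟩ := hS.exists_mem_diagonalGraph_sqrt ha h
      exact ⟨y, hxy, (hcomp hxy).2 h⟩
    · rintro ⟨y, hxy, hyz⟩
      exact (hcomp hxy).1 hyz

lemma eq_diagonalOp_of_isNonnegSqrt (hS : IsOrthogonalDecomposition S) {a : ι → ℝ}
    (ha : ∀ i, 0 ≤ a i) {B : E →ₗ.[ℂ] E} (hB : IsNonnegSqrt (diagonalOp S a) B) :
    B = diagonalOp S fun i => √(a i) := by
  have heigen : ∀ i, ∀ v ∈ S i, (v, (√(a i) : ℂ) • v) ∈ B.graph := by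
    intro i v hv
    have hv' := hS.mk_smul_mem_diagonalGraph a hv
    rw [← hS.graph_diagonalOp, hB.2.2, ← Real.mul_self_sqrt (ha i)] at hv'
    obtain ⟨y, hvy, hyv⟩ := hv'
    rwa [← eq_smul_of_isNonnegSqrt hB (Real.sqrt_nonneg _) hvy hyv]
  have hle : B.graph ≤ diagonalGraph S fun i => √(a i) := by
    rintro ⟨x, y⟩ hxy i v hv
    rw [← inner_eq_inner_of_isSelfAdjoint hB.1 (heigen i v hv) hxy, inner_smul_left,
      Complex.conj_ofReal]
  refine LinearPMap.eq_of_eq_graph ?_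
  rw [hS.graph_diagonalOp]
  exact le_antisymm hle (hS.diagonalGraph_le hB.1.isClosed heigen)

lemma opSqrt_diagonalOp (hS : IsOrthogonalDecomposition S) {a : ι → ℝ} (ha : ∀ i, 0 ≤ a i) :
    opSqrt (diagonalOp S a) = diagonalOp S fun i => √(a i) :=
  hS.eq_diagonalOp_of_isNonnegSqrt ha
    (Classical.epsilon_spec (p := IsNonnegSqrt _) ⟨_, hS.isNonnegSqrt_diagonalOp ha⟩)

end IsOrthogonalDecomposition

end SquareRoot

section ExtendedNorm

variable {ι E F : Type*} [NormedAddCommGroup E] [InnerProductSpace ℂ E]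
  [NormedAddCommGroup F] [InnerProductSpace ℂ F]

open scoped ENNReal

/-- The quadratic form `‖A x‖²` of an unbounded operator as a function on the whole space, with
the value `∞` outside the domain of `A`. -/
def extNormSq (A : E →ₗ.[ℂ] F) (x : E) : ℝ≥0∞ := ⨅ h : x ∈ A.domain, ‖A ⟨x, h⟩‖ₑ ^ 2

lemma extNormSq_of_mem_graph {A : E →ₗ.[ℂ] F} {x : E} {y : F} (h : (x, y) ∈ A.graph) :
    extNormSq A x = ‖y‖ₑ ^ 2 := by
  obtain ⟨⟨x, hx⟩, rfl, rfl⟩ := (LinearPMap.mem_graph_iff A).1 h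
  exact iInf_pos hx

lemma extNormSq_eq_ofReal {A : E →ₗ.[ℂ] F} {x : E} (h : x ∈ A.domain) :
    extNormSq A x = ENNReal.ofReal (‖A ⟨x, h⟩‖ ^ 2) := by
  rw [extNormSq, iInf_pos h, ENNReal.ofReal_pow (norm_nonneg _), ofReal_norm]

lemma extNormSq_ne_top_iff {A : E →ₗ.[ℂ] F} {x : E} : extNormSq A x ≠ ∞ ↔ x ∈ A.domain := by
  refine ⟨fun h => ?_, fun h => extNormSq_eq_ofReal h ▸ ENNReal.ofReal_ne_top⟩
  by_contra hx
  exact h (iInf_neg hx)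

lemma extNormSq_opSqrt_diagonalOp [CompleteSpace E] {S : ι → Set E}
    (hS : IsOrthogonalDecomposition S) {a : ι → ℝ} (ha : ∀ i, 0 ≤ a i) (x : E) :
    extNormSq (opSqrt (diagonalOp S a)) x =
      ∑' i, ENNReal.ofReal (a i) * ‖component S i x‖ₑ ^ 2 := by
  have hterm : ∀ i, ENNReal.ofReal (a i) * ‖component S i x‖ₑ ^ 2 =
      ‖(√(a i) : ℂ) • component S i x‖ₑ ^ 2 := fun i => by
    rw [enorm_smul, mul_pow, ← ofReal_norm (√(a i) : ℂ), Complex.norm_real,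
      Real.norm_of_nonneg (Real.sqrt_nonneg _), ← ENNReal.ofReal_pow (Real.sqrt_nonneg _),
      Real.sq_sqrt (ha i)]
  simp only [hS.opSqrt_diagonalOp ha, hterm]
  by_cases hx : x ∈ (diagonalOp S fun i => √(a i)).domain
  · obtain ⟨y, hxy⟩ := LinearPMap.mem_domain_iff.1 hx
    rw [extNormSq_of_mem_graph hxy, ← hS.tsum_enorm_sq_component]
    rw [hS.graph_diagonalOp] at hxy
    simp only [mem_diagonalGraph_iff_component.1 hxy]
  · rw [extNormSq, iInf_neg hx]
    by_contra! hne
    have hsum : Summable fun i => ‖(√(a i) : ℂ) • component S i x‖ ^ 2 := by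
      simpa using ENNReal.summable_toReal hne.symm
    obtain ⟨y, hy⟩ := hS.exists_component_eq (fun i => smul_mem _ _ (component_mem S i x)) hsum
    refine hx (LinearPMap.mem_domain_iff.2 ⟨y, ?_⟩)
    rw [hS.graph_diagonalOp]
    exact mem_diagonalGraph_iff_component.2 hy

variable {G : ι → Type*} [∀ i, NormedAddCommGroup (G i)] [∀ i, InnerProductSpace ℂ (G i)]

lemma mem_domain_iff_of_iSup_extNormSq {A : E →ₗ.[ℂ] F} {B : ∀ i, E →ₗ.[ℂ] G i} {x : E}
    (h : ⨆ i, extNormSq (B i) x = extNormSq A x) :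
    x ∈ A.domain ↔ ∃ hB : ∀ i, x ∈ (B i).domain,
      BddAbove (Set.range fun i => ‖B i ⟨x, hB i⟩‖ ^ 2) := by
  rw [← extNormSq_ne_top_iff, ← h]
  constructor
  · intro hne
    have hB : ∀ i, x ∈ (B i).domain := fun i =>
      extNormSq_ne_top_iff.1 (ne_top_of_le_ne_top hne (le_iSup (fun i => extNormSq (B i) x) i))
    refine ⟨hB, (⨆ i, extNormSq (B i) x).toReal, ?_⟩
    rintro _ ⟨i, rfl⟩
    refine (ENNReal.ofReal_le_iff_le_toReal hne).1 ?_
    rw [← extNormSq_eq_ofReal]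
    exact le_iSup (fun i => extNormSq (B i) x) i
  · rintro ⟨hB, C, hC⟩
    refine ne_top_of_le_ne_top (ENNReal.ofReal_ne_top (r := C)) (iSup_le fun i => ?_)
    rw [extNormSq_eq_ofReal (hB i)]
    exact ENNReal.ofReal_le_ofReal (hC ⟨i, rfl⟩)

lemma isLUB_norm_sq_of_iSup_extNormSq [Nonempty ι] {A : E →ₗ.[ℂ] F} {B : ∀ i, E →ₗ.[ℂ] G i} {x : E}
    (h : ⨆ i, extNormSq (B i) x = extNormSq A x) (hA : x ∈ A.domain)
    (hB : ∀ i, x ∈ (B i).domain) :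
    IsLUB (Set.range fun i => ‖B i ⟨x, hB i⟩‖ ^ 2) (‖A ⟨x, hA⟩‖ ^ 2) := by
  have hle : ∀ C : ℝ, 0 ≤ C → (‖A ⟨x, hA⟩‖ ^ 2 ≤ C ↔ ∀ i, ‖B i ⟨x, hB i⟩‖ ^ 2 ≤ C) := by
    intro C hC
    simp only [← ENNReal.ofReal_le_ofReal_iff hC, ← extNormSq_eq_ofReal, ← h, iSup_le_iff]
  refine ⟨?_, fun C hC => ?_⟩
  · rintro _ ⟨i, rfl⟩
    exact (hle _ (sq_nonneg _)).1 le_rfl i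
  · have hC' : ∀ i, ‖B i ⟨x, hB i⟩‖ ^ 2 ≤ C := fun i => hC ⟨i, rfl⟩
    exact (hle C ((sq_nonneg _).trans (hC' (Classical.arbitrary ι)))).2 hC'

end ExtendedNorm

section TensorProduct

variable {E F : Type*} [NormedAddCommGroup E] [InnerProductSpace ℂ E]
  [NormedAddCommGroup F] [InnerProductSpace ℂ F]

lemma mem_of_dense_span {s : Set E} (hs : Dense (span ℂ s : Set E)) {K : Submodule ℂ E}
    (hK : IsClosed (K : Set E)) (h : s ⊆ K) (x : E) : x ∈ K :=
  hK.closure_subset_iff.2 (span_le.2 h) (hs x)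

lemma dense_span_of_forall_mem {s : Set E}
    (h : ∀ K : Submodule ℂ E, IsClosed (K : Set E) → s ⊆ K → ∀ x, x ∈ K) :
    Dense (span ℂ s : Set E) :=
  h _ (isClosed_topologicalClosure _) (subset_span.trans (le_topologicalClosure _))

lemma inner_elemTensor (x x' : E) (y y' : F) :
    ⟪elemTensor x y, elemTensor x' y'⟫_ℂ = ⟪x, x'⟫_ℂ * ⟪y, y'⟫_ℂ := by
  rw [elemTensor, elemTensor, UniformSpace.Completion.inner_coe, TensorProduct.inner_tmul]

/-- The continuous linear map `y ↦ x ⊗ y`. -/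
def elemTensorLeft (x : E) : F →L[ℂ] HilbertTensor E F :=
  UniformSpace.Completion.toComplL.comp (TensorProduct.mkL ℂ E F x)

/-- The continuous linear map `x ↦ x ⊗ y`. -/
def elemTensorRight (y : F) : E →L[ℂ] HilbertTensor E F :=
  UniformSpace.Completion.toComplL.comp ((TensorProduct.mkL ℂ E F).flip y)

lemma dense_span_range_elemTensor :
    Dense (span ℂ (Set.image2 elemTensor Set.univ Set.univ : Set (HilbertTensor E F)) :
      Set (HilbertTensor E F)) := by
  refine dense_span_of_forall_mem fun K hK h z => ?_
  induction z using UniformSpace.Completion.induction_on with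
  | hp => exact hK
  | ih z =>
    induction z with
    | zero => rw [UniformSpace.Completion.coe_zero]; exact K.zero_mem
    | tmul x y => exact h (Set.mem_image2_of_mem trivial trivial)
    | add a b ha hb => rw [UniformSpace.Completion.coe_add]; exact K.add_mem ha hb

lemma dense_span_image2_elemTensor {s : Set E} {t : Set F} (hs : Dense (span ℂ s : Set E))
    (ht : Dense (span ℂ t : Set F)) :
    Dense (span ℂ (Set.image2 elemTensor s t : Set (HilbertTensor E F)) :
      Set (HilbertTensor E F)) := by
  refine dense_span_of_forall_mem fun K hK h =>
    mem_of_dense_span dense_span_range_elemTensor hK ?_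
  have hleft : ∀ x ∈ s, ∀ y : F, elemTensor x y ∈ K := fun x hx =>
    mem_of_dense_span (K := K.comap (elemTensorLeft (F := F) x).toLinearMap) ht
      (hK.preimage (elemTensorLeft x).continuous) fun y hy => h ⟨x, hx, y, hy, rfl⟩
  rintro _ ⟨x, -, y, -, rfl⟩
  exact mem_of_dense_span (K := K.comap (elemTensorRight (E := E) y).toLinearMap) hs
    (hK.preimage (elemTensorRight y).continuous) (fun x hx => hleft x hx y) x

lemma IsOrthogonalDecomposition.idTensor {ι : Type*} {S : ι → Set F}
    (hS : IsOrthogonalDecomposition S) :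
    IsOrthogonalDecomposition fun i =>
      (Set.image2 elemTensor Set.univ (S i) : Set (HilbertTensor E F)) where
  inner_eq_zero i j hij := by
    rintro _ ⟨x, -, v, hv, rfl⟩ _ ⟨y, -, w, hw, rfl⟩
    rw [inner_elemTensor, hS.inner_eq_zero hij v hv w hw, mul_zero]
  dense_span := by
    rw [← Set.image2_iUnion_right]
    exact dense_span_image2_elemTensor (by simp) hS.dense_span

lemma IsOrthogonalDecomposition.idTensor_diagonalOp [CompleteSpace F] {ι : Type*}
    {S : ι → Set F} (hS : IsOrthogonalDecomposition S) (a : ι → ℝ) :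
    FockNumber.idTensor E (diagonalOp S a) =
      diagonalOp (fun i => Set.image2 elemTensor Set.univ (S i)) a := by
  have hgraph (y : (diagonalOp S a).domain) : ((y : F), diagonalOp S a y) ∈ diagonalGraph S a :=
    hS.graph_diagonalOp a ▸ LinearPMap.mem_graph _ y
  refine hS.idTensor.toLinearPMap_eq_diagonalOp (isClosed_topologicalClosure _) ?_
    (topologicalClosure_minimal _ (span_le.2 ?_) (isClosed_diagonalGraph _ _))
  · rintro i _ ⟨x, -, v, hv, rfl⟩
    have hmem := hS.graph_diagonalOp a ▸ hS.mk_smul_mem_diagonalGraph a hv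
    obtain ⟨y, rfl, hy⟩ := (LinearPMap.mem_graph_iff _).1 hmem
    refine le_topologicalClosure _ (subset_span ⟨x, y, ?_⟩)
    rw [hy]
    exact congrArg _ ((elemTensorLeft x).map_smul _ _).symm
  · rintro _ ⟨x, y, rfl⟩ i _ ⟨x', -, v, hv, rfl⟩
    rw [inner_elemTensor, inner_elemTensor, hgraph y i v hv, mul_left_comm]

end TensorProduct

section Unitary

lemma surjective_of_denseRange {E F : Type*} [NormedAddCommGroup E] [NormedSpace ℂ E]
    [CompleteSpace E] [NormedAddCommGroup F] [NormedSpace ℂ F] {L : E →ₗᵢ[ℂ] F}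
    (hL : DenseRange L) : Function.Surjective L := by
  rw [← Set.range_eq_univ, ← L.isometry.isClosedEmbedding.isClosed_range.closure_eq]
  exact hL.closure_range

variable {E F : Type*} [NormedAddCommGroup E] [InnerProductSpace ℂ E]
  [NormedAddCommGroup F] [InnerProductSpace ℂ F]

lemma inner_fst_eq_inner_snd_of_mem_closure {R : Set (E × F)}
    (hR : ∀ p ∈ R, ∀ q ∈ R, ⟪p.1, q.1⟫_ℂ = ⟪p.2, q.2⟫_ℂ) {p q : E × F}
    (hp : p ∈ (span ℂ R).topologicalClosure) (hq : q ∈ (span ℂ R).topologicalClosure) :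
    ⟪p.1, q.1⟫_ℂ = ⟪p.2, q.2⟫_ℂ := by
  let K (p : E × F) : Submodule ℂ (E × F) := LinearMap.ker
    (((innerSL ℂ p.1).comp (.fst ℂ E F) - (innerSL ℂ p.2).comp (.snd ℂ E F) :
      E × F →L[ℂ] ℂ) : E × F →ₗ[ℂ] ℂ)
  have mem_K {p q : E × F} : q ∈ K p ↔ ⟪p.1, q.1⟫_ℂ = ⟪p.2, q.2⟫_ℂ := by
    simp [K, sub_eq_zero]
  have K_comm {p q : E × F} (h : q ∈ K p) : p ∈ K q := by
    rw [mem_K] at h ⊢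
    rw [← inner_conj_symm, h, inner_conj_symm]
  have closure_le {p : E × F} (h : R ⊆ K p) : (span ℂ R).topologicalClosure ≤ K p :=
    topologicalClosure_minimal _ (span_le.2 h) (ContinuousLinearMap.isClosed_ker _)
  have hK : ∀ r ∈ R, p ∈ K r := fun r hr => closure_le (fun r' hr' => mem_K.2 (hR r hr r' hr')) hp
  exact mem_K.1 (closure_le (fun r hr => K_comm (hK r hr)) hq)

lemma exists_linearIsometryEquiv_of_isClosed [CompleteSpace E] [CompleteSpace F]
    {G : Submodule ℂ (E × F)}
    (hG : IsClosed (G : Set (E × F))) (hnorm : ∀ p ∈ G, ‖p.1‖ = ‖p.2‖)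
    (hfst : Dense (G.map (LinearMap.fst ℂ E F) : Set E))
    (hsnd : Dense (G.map (LinearMap.snd ℂ E F) : Set F)) :
    ∃ V : E ≃ₗᵢ[ℂ] F, ∀ p, p ∈ G ↔ V p.1 = p.2 := by
  have : CompleteSpace G := hG.completeSpace_coe
  let π₁ : G →ₗᵢ[ℂ] E :=
    { toLinearMap := (LinearMap.fst ℂ E F).domRestrict G
      norm_map' p := (max_eq_left (hnorm p p.2).ge).symm }
  let π₂ : G →ₗᵢ[ℂ] F :=
    { toLinearMap := (LinearMap.snd ℂ E F).domRestrict G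
      norm_map' p := (max_eq_right (hnorm p p.2).le).symm }
  rw [map_coe, Set.image_eq_range] at hfst hsnd
  have hπ₁ : Function.Surjective π₁ := surjective_of_denseRange hfst
  have hπ₂ : Function.Surjective π₂ := surjective_of_denseRange hsnd
  let e₁ := LinearIsometryEquiv.ofSurjective π₁ hπ₁
  let e₂ := LinearIsometryEquiv.ofSurjective π₂ hπ₂
  have hV (p : G) : e₂ (e₁.symm p.1.1) = p.1.2 := congrArg e₂ (e₁.symm_apply_apply p)
  refine ⟨e₁.symm.trans e₂, fun p => ⟨fun hp => hV ⟨p, hp⟩, fun hp => ?_⟩⟩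
  obtain ⟨q, hq : q.1.1 = p.1⟩ := hπ₁ p.1
  have hqp : q.1 = p := Prod.ext hq (by rw [← hV q, hq]; exact hp)
  exact hqp ▸ q.2

lemma mem_graph_toPMap_iff (L : E →ₗ[ℂ] F) {p : E × F} :
    p ∈ (L.toPMap ⊤).graph ↔ L p.1 = p.2 := by
  simp [LinearPMap.mem_graph_iff]

lemma exists_linearIsometryEquiv_of_gram [CompleteSpace E] [CompleteSpace F] {R : Set (E × F)}
    (hR : ∀ p ∈ R, ∀ q ∈ R, ⟪p.1, q.1⟫_ℂ = ⟪p.2, q.2⟫_ℂ)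
    (hfst : Dense (span ℂ (Prod.fst '' R) : Set E))
    (hsnd : Dense (span ℂ (Prod.snd '' R) : Set F)) :
    ∃ V : E ≃ₗᵢ[ℂ] F, (∀ p ∈ R, V p.1 = p.2) ∧
      (span ℂ R).topologicalClosure.toLinearPMap = (V : E →ₗ[ℂ] F).toPMap ⊤ := by
  set G := (span ℂ R).topologicalClosure
  have hRG : R ⊆ G := subset_span.trans (le_topologicalClosure _)
  have hnorm : ∀ p ∈ G, ‖p.1‖ = ‖p.2‖ := fun p hp => by
    rw [norm_eq_sqrt_re_inner (𝕜 := ℂ), norm_eq_sqrt_re_inner (𝕜 := ℂ),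
      inner_fst_eq_inner_snd_of_mem_closure hR hp hp]
  obtain ⟨V, hV⟩ := exists_linearIsometryEquiv_of_isClosed
    (isClosed_topologicalClosure (span ℂ R)) hnorm
    (hfst.mono (span_le.2 (Set.image_mono hRG))) (hsnd.mono (span_le.2 (Set.image_mono hRG)))
  refine ⟨V, fun p hp => (hV p).1 (hRG hp), LinearPMap.eq_of_eq_graph ?_⟩
  rw [toLinearPMap_graph_eq]
  · ext p
    rw [hV, mem_graph_toPMap_iff]; rfl
  · rintro p hp (hp0 : p.1 = 0)
    rw [← (hV p).1 hp, hp0, map_zero]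

lemma conjBy_toPMap_diagonalOp [CompleteSpace F] {ι : Type*} {T : ι → Set F}
    (hT : IsOrthogonalDecomposition T) (a : ι → ℝ) (V : E ≃ₗᵢ[ℂ] F) :
    conjBy ((V : E →ₗ[ℂ] F).toPMap ⊤) (diagonalOp T a) = diagonalOp (fun i => V ⁻¹' T i) a := by
  refine congrArg Submodule.toLinearPMap (Submodule.ext fun p => ?_)
  calc (∃ q ∈ (diagonalOp T a).graph, (p.1, q.1) ∈ ((V : E →ₗ[ℂ] F).toPMap ⊤).graph ∧
        (p.2, q.2) ∈ ((V : E →ₗ[ℂ] F).toPMap ⊤).graph)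
    _ ↔ (V p.1, V p.2) ∈ diagonalGraph T a := by
        simp [hT.graph_diagonalOp]
    _ ↔ p ∈ diagonalGraph (fun i => V ⁻¹' T i) a := by
        refine forall_congr' fun i => V.surjective.forall.trans (forall₂_congr fun v _ => ?_)
        simp only [V.inner_map_map]

lemma IsOrthogonalDecomposition.preimage {ι : Type*} {T : ι → Set F}
    (hT : IsOrthogonalDecomposition T) (V : E ≃ₗᵢ[ℂ] F) :
    IsOrthogonalDecomposition fun i => V ⁻¹' T i where
  inner_eq_zero i j hij v hv w hw := by
    rw [← V.inner_map_map]
    exact hT.inner_eq_zero hij _ hv _ hw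
  dense_span := by
    refine dense_span_of_forall_mem fun K hK h x => ?_
    have := mem_of_dense_span (K := K.comap (V.symm : F →ₗ[ℂ] E)) hT.dense_span
      (hK.preimage V.symm.continuous) (fun w hw => h ?_) (V x)
    · simpa using this
    · simpa using hw

lemma exists_idTensor_toPMap_eq (H : Type*) [NormedAddCommGroup H] [InnerProductSpace ℂ H]
    (V : E ≃ₗᵢ[ℂ] F) :
    ∃ W : HilbertTensor H E ≃ₗᵢ[ℂ] HilbertTensor H F,
      (∀ x y, W (elemTensor x y) = elemTensor x (V y)) ∧
      idTensor H ((V : E →ₗ[ℂ] F).toPMap ⊤) =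
        (W : HilbertTensor H E →ₗ[ℂ] HilbertTensor H F).toPMap ⊤ := by
  let R : Set (HilbertTensor H E × HilbertTensor H F) :=
    {p | ∃ (x : H) (y : ((V : E →ₗ[ℂ] F).toPMap ⊤).domain),
      p = (elemTensor x (y : E), elemTensor x ((V : E →ₗ[ℂ] F).toPMap ⊤ y))}
  have mem_R (x : H) (y : E) : (elemTensor x y, elemTensor x (V y)) ∈ R :=
    ⟨x, ⟨y, trivial⟩, rfl⟩
  have gram_R : ∀ p ∈ R, ∀ q ∈ R, ⟪p.1, q.1⟫_ℂ = ⟪p.2, q.2⟫_ℂ := by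
    rintro _ ⟨x, y, rfl⟩ _ ⟨x', y', rfl⟩
    rw [inner_elemTensor, inner_elemTensor]
    exact congrArg _ (V.inner_map_map y y').symm
  obtain ⟨W, hWR, hW⟩ := exists_linearIsometryEquiv_of_gram gram_R
    (dense_span_range_elemTensor.mono <| span_mono <| by
      rintro _ ⟨x, -, y, -, rfl⟩
      exact ⟨_, mem_R x y, rfl⟩)
    (dense_span_range_elemTensor.mono <| span_mono <| by
      rintro _ ⟨x, -, y, -, rfl⟩
      exact ⟨_, mem_R x (V.symm y), congrArg (elemTensor x) (V.apply_symm_apply y)⟩)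
  exact ⟨W, fun x y => hWR _ (mem_R x y), hW⟩

lemma conjBy_idTensor_diagonalOp (H : Type*) [NormedAddCommGroup H] [InnerProductSpace ℂ H]
    {ι κ G K : Type*} [NormedAddCommGroup G] [InnerProductSpace ℂ G] [NormedAddCommGroup K]
    [InnerProductSpace ℂ K] [CompleteSpace K] {S : κ → Set F}
    {T : ι → Set K} (hS : IsOrthogonalDecomposition S) (hT : IsOrthogonalDecomposition T)
    (V : F ≃ₗᵢ[ℂ] HilbertTensor G K) {p : κ → ι}
    (hV : ∀ k, ∀ ψ ∈ S k, V ψ ∈ Set.image2 elemTensor Set.univ (T (p k))) (a : ι → ℝ) :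
    conjBy (idTensor H ((V : F →ₗ[ℂ] HilbertTensor G K).toPMap ⊤))
        (idTensor H (idTensor G (diagonalOp T a))) =
      diagonalOp (fun k => Set.image2 elemTensor Set.univ (S k)) (a ∘ p) := by
  obtain ⟨W, hWxy, hW⟩ := exists_idTensor_toPMap_eq H V
  have hGT := hT.idTensor (E := G)
  have hHGT := hGT.idTensor (E := H)
  rw [hW, hT.idTensor_diagonalOp, hGT.idTensor_diagonalOp, conjBy_toPMap_diagonalOp hHGT]
  refine (hHGT.preimage W).diagonalOp_eq_of_subset hS.idTensor ?_ a
  rintro k _ ⟨x, -, ψ, hψ, rfl⟩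
  rw [Set.mem_preimage, hWxy]
  exact ⟨x, trivial, _, hV k ψ hψ, rfl⟩

end Unitary

section Tensor

lemma multilinear_mem_of_dense_span {ι E F : Type*} [Finite ι]
    [NormedAddCommGroup E] [InnerProductSpace ℂ E] [NormedAddCommGroup F] [InnerProductSpace ℂ F]
    (M : ContinuousMultilinearMap ℂ (fun _ : ι => E) F) {s : Set E}
    (hs : Dense (span ℂ s : Set E)) {K : Submodule ℂ F} (hK : IsClosed (K : Set F))
    (h : ∀ f, (∀ i, f i ∈ s) → M f ∈ K) (f : ι → E) : M f ∈ K := by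
  classical
  cases nonempty_fintype ι
  suffices ∀ J : Finset ι, ∀ f, (∀ i ∉ J, f i ∈ s) → M f ∈ K from
    this Finset.univ f fun i hi => absurd (Finset.mem_univ i) hi
  intro J
  induction J using Finset.induction_on with
  | empty => exact fun f hf => h f fun i => hf i (Finset.notMem_empty i)
  | insert a J _ ih =>
    intro f hf
    let A : E →L[ℂ] F := M.toContinuousLinearMap f a
    have hA : ∀ y ∈ s, A y ∈ K := fun y hy => ih (Function.update f a y) fun i hi => by
      obtain rfl | hia := eq_or_ne i a
      · rwa [Function.update_self]
      · rw [Function.update_of_ne hia]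
        exact hf i (by simp [hia, hi])
    have hfa : A (f a) ∈ K :=
      mem_of_dense_span (K := K.comap A.toLinearMap) hs (hK.preimage A.continuous) hA (f a)
    rwa [M.toContinuousLinearMap_apply, Function.update_eq_self] at hfa

lemma ae_eq_zero_of_generateFrom {Y : Type*} [hY : MeasurableSpace Y] {ν : Measure Y} {f : Y → ℂ}
    (hf : Integrable f ν) {C : Set (Set Y)} (hgen : hY = MeasurableSpace.generateFrom C)
    (hC : IsPiSystem C) (huniv : Set.univ ∈ C) (hmeas : ∀ s ∈ C, MeasurableSet s)
    (h : ∀ s ∈ C, ∫ y in s, f y ∂ν = 0) : f =ᵐ[ν] 0 := by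
  have hC' : ∀ s ∈ C, ν.withDensityᵥ f s = (0 : VectorMeasure Y ℂ) s := fun s hs =>
    (withDensityᵥ_apply hf (hmeas s hs)).trans (h s hs)
  refine hf.ae_eq_of_withDensityᵥ_eq (integrable_zero _ _ _) ?_
  rw [withDensityᵥ_zero, VectorMeasure.ext_of_generateFrom C hC' hgen hC (hC' _ huniv)]

variable {X : Type*} [MeasurableSpace X] {μ : Measure X} [SigmaFinite μ] {n : ℕ}

lemma coeFn_tensor (f : Fin n → L2 μ) :
    tensor f =ᵐ[Measure.pi fun _ : Fin n => μ] fun x => ∏ i, f i (x i) :=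
  (memLp_tensor f).coeFn_toLp

lemma ae_pi_of_forall_ae {p : Fin n → X → Prop} (h : ∀ i, ∀ᵐ k ∂μ, p i k) :
    ∀ᵐ x ∂(Measure.pi fun _ : Fin n => μ), ∀ i, p i (x i) :=
  eventually_all.2 fun i => (Measure.quasiMeasurePreserving_eval (fun _ : Fin n => μ) i).ae (h i)

lemma inner_tensor (f g : Fin n → L2 μ) :
    ⟪tensor f, tensor g⟫_ℂ = ∏ i, ⟪f i, g i⟫_ℂ := by
  simp only [L2.inner_def]
  rw [← integral_fintype_prod_eq_prod (𝕜 := ℂ) (fun i x => ⟪f i x, g i x⟫_ℂ)]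
  refine integral_congr_ae ?_
  filter_upwards [coeFn_tensor f, coeFn_tensor g] with x hf hg
  simp only [hf, hg, RCLike.inner_apply, map_prod, Finset.prod_mul_distrib]

lemma norm_tensor (f : Fin n → L2 μ) : ‖tensor f‖ = ∏ i, ‖f i‖ := by
  have h : ((‖tensor f‖ : ℂ)) ^ 2 = ((∏ i, ‖f i‖ : ℝ) : ℂ) ^ 2 := by
    simpa [inner_self_eq_norm_sq_to_K, Finset.prod_pow] using inner_tensor f f
  exact (sq_eq_sq₀ (norm_nonneg _) (Finset.prod_nonneg fun i _ => norm_nonneg _)).1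
    (by exact_mod_cast h)

lemma coeFn_tensor_update [DecidableEq (Fin n)] (f : Fin n → L2 μ) (i : Fin n) (a : L2 μ) :
    tensor (Function.update f i a) =ᵐ[Measure.pi fun _ : Fin n => μ]
      fun x => a (x i) * ∏ j ∈ Finset.univ \ {i}, f j (x j) := by
  filter_upwards [coeFn_tensor (Function.update f i a)] with x hx
  rw [hx, ← Finset.prod_update_of_mem (Finset.mem_univ i) (fun j => f j (x j))]
  exact Finset.prod_congr rfl fun j _ => Function.apply_update (fun j (g : L2 μ) => g (x j)) f i a j

variable (μ n) in
/-- The tensor `f₁ ⊗ ⋯ ⊗ fₙ` as a continuous multilinear map of `f₁, …, fₙ`. -/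
def tensorMultilinear : ContinuousMultilinearMap ℂ (fun _ : Fin n => L2 μ) (L2Pow μ n) :=
  MultilinearMap.mkContinuous
    { toFun := tensor
      map_update_add' f i a b := by
        refine Lp.ext ?_
        filter_upwards [coeFn_tensor_update f i (a + b), coeFn_tensor_update f i a,
          coeFn_tensor_update f i b, ae_pi_of_forall_ae fun _ => Lp.coeFn_add a b,
          Lp.coeFn_add (tensor (Function.update f i a)) (tensor (Function.update f i b))]
          with x hab ha hb hadd hsum
        rw [hab, hsum, Pi.add_apply, ha, hb, hadd i, Pi.add_apply, add_mul]
      map_update_smul' f i c a := by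
        refine Lp.ext ?_
        filter_upwards [coeFn_tensor_update f i (c • a), coeFn_tensor_update f i a,
          ae_pi_of_forall_ae fun _ => Lp.coeFn_smul c a,
          Lp.coeFn_smul c (tensor (Function.update f i a))] with x hca ha hsmul hx
        rw [hca, hx, Pi.smul_apply, ha, hsmul i, Pi.smul_apply, smul_mul_assoc] } 1 fun f => by
    rw [one_mul]
    exact (norm_tensor f).le

lemma tensor_indicatorConstLp {s : Fin n → Set X} (hs : ∀ i, MeasurableSet (s i))
    (hμ : ∀ i, μ (s i) ≠ ⊤) (hμ' : Measure.pi (fun _ : Fin n => μ) (Set.univ.pi s) ≠ ⊤) :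
    tensor (fun i => indicatorConstLp 2 (hs i) (hμ i) (1 : ℂ)) =
      indicatorConstLp 2 (MeasurableSet.univ_pi hs) hμ' (1 : ℂ) := by
  classical
  refine Lp.ext ?_
  filter_upwards [coeFn_tensor fun i => indicatorConstLp 2 (hs i) (hμ i) (1 : ℂ),
    ae_pi_of_forall_ae fun i => indicatorConstLp_coeFn (p := 2) (hs := hs i) (hμs := hμ i)
      (c := (1 : ℂ)),
    indicatorConstLp_coeFn (p := 2) (hs := MeasurableSet.univ_pi hs) (hμs := hμ') (c := (1 : ℂ))]
    with x hx hfactor hbox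
  rw [hx, hbox, Finset.prod_congr rfl fun i _ => hfactor i]
  simp only [Set.indicator_apply, Set.mem_univ_pi, Finset.prod_ite_zero, Finset.mem_univ,
    true_imp_iff, Finset.prod_const_one]

lemma setIntegral_pi_eq_zero_of_inner_tensor {g : L2Pow μ n}
    (hg : ∀ f : Fin n → L2 μ, ⟪tensor f, g⟫_ℂ = 0) {s : Fin n → Set X}
    (hs : ∀ i, MeasurableSet (s i)) (hμ : ∀ i, μ (s i) ≠ ⊤) :
    ∫ x in Set.univ.pi s, g x ∂(Measure.pi fun _ : Fin n => μ) = 0 := by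
  have hμ' : Measure.pi (fun _ : Fin n => μ) (Set.univ.pi s) ≠ ⊤ := by
    rw [Measure.pi_pi]
    exact ENNReal.prod_ne_top fun i _ => hμ i
  rw [← L2.inner_indicatorConstLp_one (𝕜 := ℂ) (MeasurableSet.univ_pi hs) hμ' g,
    ← tensor_indicatorConstLp hs hμ hμ']
  exact hg _

lemma ae_restrict_pi_eq_zero_of_inner_tensor {g : L2Pow μ n}
    (hg : ∀ f : Fin n → L2 μ, ⟪tensor f, g⟫_ℂ = 0) {s : Fin n → Set X}
    (hs : ∀ i, MeasurableSet (s i)) (hμ : ∀ i, μ (s i) ≠ ⊤) :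
    g =ᵐ[(Measure.pi fun _ : Fin n => μ).restrict (Set.univ.pi s)] 0 := by
  have : IsFiniteMeasure ((Measure.pi fun _ : Fin n => μ).restrict (Set.univ.pi s)) :=
    ⟨by simpa using ENNReal.prod_lt_top fun i _ => (hμ i).lt_top⟩
  refine ae_eq_zero_of_generateFrom (((Lp.memLp g).restrict _).integrable one_le_two)
    generateFrom_pi.symm isPiSystem_pi ⟨fun _ => Set.univ, fun _ _ => MeasurableSet.univ, ?_⟩ ?_ ?_
  · exact Set.pi_univ _
  · rintro _ ⟨t, ht, rfl⟩
    exact MeasurableSet.univ_pi fun i => ht i trivial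
  · rintro _ ⟨t, ht, rfl⟩
    rw [Measure.restrict_restrict (MeasurableSet.univ_pi fun i => ht i trivial),
      ← Set.pi_inter_distrib]
    exact setIntegral_pi_eq_zero_of_inner_tensor hg (fun i => (ht i trivial).inter (hs i))
      fun i => measure_ne_top_of_subset Set.inter_subset_right (hμ i)

lemma eq_zero_of_inner_tensor {g : L2Pow μ n} (hg : ∀ f : Fin n → L2 μ, ⟪tensor f, g⟫_ℂ = 0) :
    g = 0 := by
  have hcover : ⋃ N, Set.univ.pi (fun _ : Fin n => spanningSets μ N) = Set.univ := by
    rw [Set.iUnion_univ_pi_of_monotone fun _ => monotone_spanningSets μ]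
    simp only [iUnion_spanningSets, Set.pi_univ]
  have h := (ae_restrict_iUnion_iff _ _).2 fun N => ae_restrict_pi_eq_zero_of_inner_tensor hg
    (fun _ => measurableSet_spanningSets μ N) fun _ => (measure_spanningSets_lt_top μ N).ne
  rw [hcover, Measure.restrict_univ] at h
  exact (Lp.eq_zero_iff_ae_eq_zero).2 h

lemma dense_span_tensor {s : Set (L2 μ)} (hs : Dense (span ℂ s : Set (L2 μ))) :
    Dense (span ℂ (tensor '' {f : Fin n → L2 μ | ∀ i, f i ∈ s}) : Set (L2Pow μ n)) := by
  have hrange : Dense (span ℂ (Set.range (tensor : (Fin n → L2 μ) → L2Pow μ n)) :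
      Set (L2Pow μ n)) := by
    rw [dense_iff_topologicalClosure_eq_top, topologicalClosure_eq_top_iff, eq_bot_iff]
    exact fun g hg => eq_zero_of_inner_tensor fun f =>
      mem_orthogonal_span_iff.1 hg _ (Set.mem_range_self f)
  refine dense_span_of_forall_mem fun K hK h => mem_of_dense_span hrange hK ?_
  rintro _ ⟨f, rfl⟩
  exact multilinear_mem_of_dense_span (tensorMultilinear μ n) hs hK
    (fun f hf => h ⟨f, hf, rfl⟩) f

end Tensor

section Fock

variable {X : Type*} [MeasurableSpace X] {μ : Measure X} [SigmaFinite μ] {n : ℕ}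

lemma inner_permute (σ : Equiv.Perm (Fin n)) (ψ φ : L2Pow μ n) :
    ⟪permute μ σ ψ, permute μ σ φ⟫_ℂ = ⟪ψ, φ⟫_ℂ :=
  (Lp.compMeasurePreservingₗᵢ ℂ _ (measurePreserving_perm μ σ)).inner_map_map ψ φ

lemma inner_tensor_comp_perm (τ : Equiv.Perm (Fin n)) (f : Fin n → L2 μ) (z : symPow μ n) :
    ⟪tensor fun i => f (τ i), (z : L2Pow μ n)⟫_ℂ = ⟪tensor f, (z : L2Pow μ n)⟫_ℂ := by
  rw [← inner_permute τ⁻¹ (tensor f), permute_tensor, z.2 τ⁻¹]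
  rfl

lemma inner_symTensor_left (f : Fin n → L2 μ) (z : symPow μ n) :
    ⟪symTensor f, z⟫_ℂ = (√(n.factorial : ℝ) : ℂ) * ⟪tensor f, (z : L2Pow μ n)⟫_ℂ := by
  have h : (√(n.factorial : ℝ) : ℂ) * √(n.factorial : ℝ) = n.factorial := by
    rw [← Complex.ofReal_mul, Real.mul_self_sqrt (Nat.cast_nonneg _), Complex.ofReal_natCast]
  rw [coe_inner, symTensor, inner_smul_left, sum_inner, map_inv₀, Complex.conj_ofReal]
  simp only [inner_tensor_comp_perm, Finset.sum_const, Finset.card_univ, Fintype.card_perm,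
    Fintype.card_fin, nsmul_eq_mul]
  rw [← h, mul_assoc, inv_mul_cancel_left₀]
  exact left_ne_zero_of_mul (h ▸ Nat.cast_ne_zero.2 n.factorial_ne_zero)

lemma inner_symTensor (f g : Fin n → L2 μ) :
    ⟪symTensor f, symTensor g⟫_ℂ = ∑ σ : Equiv.Perm (Fin n), ∏ i, ⟪f i, g (σ i)⟫_ℂ := by
  rw [inner_symTensor_left, symTensor, inner_smul_right, inner_sum, mul_inv_cancel_left₀]
  · simp only [inner_tensor]
  · exact Complex.ofReal_ne_zero.2 (by positivity)

instance completeSpace_symPow : CompleteSpace (symPow μ n) := by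
  have hfixed : (symPow μ n : Set (L2Pow μ n)) = ⋂ σ, {ψ | permute μ σ ψ = ψ} :=
    Set.ext fun ψ => (Set.mem_iInter (s := fun σ => {ψ | permute μ σ ψ = ψ})).symm
  have hclosed : IsClosed (symPow μ n : Set (L2Pow μ n)) := hfixed ▸ isClosed_iInter fun σ =>
    isClosed_eq (Lp.compMeasurePreservingₗᵢ ℂ _ (measurePreserving_perm μ σ)).continuous
      continuous_id
  exact hclosed.completeSpace_coe

lemma dense_span_symTensor {s : Set (L2 μ)} (hs : Dense (span ℂ s : Set (L2 μ))) :
    Dense (span ℂ (symTensor '' {f : Fin n → L2 μ | ∀ i, f i ∈ s}) : Set (symPow μ n)) := by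
  rw [dense_iff_topologicalClosure_eq_top, topologicalClosure_eq_top_iff, eq_bot_iff]
  intro z hz
  have hz0 : (z : L2Pow μ n) ∈ (span ℂ (tensor '' {f : Fin n → L2 μ | ∀ i, f i ∈ s}))ᗮ := by
    rw [mem_orthogonal_span_iff] at hz ⊢
    rintro _ ⟨f, hf, rfl⟩
    have h := hz _ ⟨f, hf, rfl⟩
    rw [inner_symTensor_left] at h
    exact (mul_eq_zero.1 h).resolve_left (Complex.ofReal_ne_zero.2 (by positivity))
  rw [(topologicalClosure_eq_top_iff.1 (dense_iff_topologicalClosure_eq_top.1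
    (dense_span_tensor hs)))] at hz0
  exact Subtype.ext hz0

lemma dense_span_univ {E : Type*} [NormedAddCommGroup E] [NormedSpace ℂ E] :
    Dense (span ℂ (Set.univ : Set E) : Set E) := by
  rw [span_univ]
  exact dense_univ

lemma isOrthogonalDecomposition_symTensor :
    IsOrthogonalDecomposition fun _ : Unit => Set.range (symTensor : (Fin n → L2 μ) → symPow μ n)
    where
  inner_eq_zero _ _ hij := absurd (Subsingleton.elim _ _) hij
  dense_span := by
    rw [Set.iUnion_const]
    exact (dense_span_symTensor dense_span_univ).mono (span_mono (Set.image_subset_range _ _))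

lemma dGammaN_mulOne (n : ℕ) : dGammaN (mulOne μ) n = diagonalOp
    (fun _ : Unit => Set.range (symTensor : (Fin n → L2 μ) → symPow μ n)) fun _ => n := by
  have hsum (f : Fin n → L2 μ) :
      ∑ j, symTensor (Function.update f j (f j)) = ((n : ℝ) : ℂ) • symTensor f := by
    simp only [Function.update_eq_self, Finset.sum_const, Finset.card_univ, Fintype.card_fin,
      Complex.ofReal_natCast, Nat.cast_smul_eq_nsmul]
  have hS := isOrthogonalDecomposition_symTensor (μ := μ) (n := n)
  have hmem (f : Fin n → L2 μ) : (symTensor f, ∑ j, symTensor (Function.update f j (f j))) ∈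
      diagonalGraph (fun _ : Unit => Set.range symTensor) fun _ => (n : ℝ) := by
    rw [hsum]
    exact hS.mk_smul_mem_diagonalGraph _ (i := ()) ⟨f, rfl⟩
  refine hS.toLinearPMap_eq_diagonalOp (isClosed_topologicalClosure _) ?_
    (topologicalClosure_minimal _ (span_le.2 ?_) (isClosed_diagonalGraph _ _))
  · rintro _ _ ⟨f, rfl⟩
    exact le_topologicalClosure _
      (subset_span ⟨fun i => ⟨f i, trivial⟩, Prod.ext rfl (hsum f).symm⟩)
  · rintro _ ⟨f, rfl⟩
    exact hmem fun i => f i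

variable (μ) in
/-- The vectors `a†(f₁) ⋯ a†(fₙ) Ω` of the Fock space, which span the `n`-particle subspace. -/
def particleVectors (n : ℕ) : Set (Fock μ) := Set.range (fockVec (n := n))

lemma inner_fockVec_left (f : Fin n → L2 μ) (ψ : Fock μ) :
    ⟪fockVec f, ψ⟫_ℂ = ⟪symTensor f, ψ n⟫_ℂ :=
  lp.inner_single_left n _ ψ

lemma inner_fockVec {m n : ℕ} (f : Fin m → L2 μ) (g : Fin n → L2 μ) :
    ⟪fockVec f, fockVec g⟫_ℂ = ∑ σ : Fin m ≃ Fin n, ∏ i, ⟪f i, g (σ i)⟫_ℂ := by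
  rw [inner_fockVec_left, fockVec]
  by_cases h : m = n
  · subst h
    rw [lp.single_apply_self, inner_symTensor]
  · rw [lp.single_apply_ne _ _ _ h, inner_zero_right]
    have : IsEmpty (Fin m ≃ Fin n) := ⟨fun e => h (Fin.equiv_iff_eq.1 ⟨e⟩)⟩
    exact (Fintype.sum_empty _).symm

lemma dense_span_fockVec {s : Set (L2 μ)} (hs : Dense (span ℂ s : Set (L2 μ))) :
    Dense (span ℂ (⋃ n, fockVec '' {f : Fin n → L2 μ | ∀ i, f i ∈ s}) : Set (Fock μ)) := by
  refine dense_span_of_forall_mem fun K hK h ψ => ?_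
  have hsingle : ∀ n (y : symPow μ n), lp.single 2 n y ∈ K := fun n => by
    let A := lp.singleContinuousLinearMap ℂ (fun n : ℕ => symPow μ n) 2 n
    refine mem_of_dense_span (K := K.comap A.toLinearMap) (dense_span_symTensor hs)
      (hK.preimage A.continuous) ?_
    rintro _ ⟨f, hf, rfl⟩
    exact h (Set.mem_iUnion_of_mem n ⟨f, hf, rfl⟩)
  exact hK.mem_of_tendsto (lp.hasSum_single ENNReal.ofNat_ne_top ψ)
    (Eventually.of_forall fun F => K.sum_mem fun n _ => hsingle n _)

variable (μ) in
lemma isOrthogonalDecomposition_particleVectors :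
    IsOrthogonalDecomposition (particleVectors μ) where
  inner_eq_zero := by
    rintro m n hmn _ ⟨f, rfl⟩ _ ⟨g, rfl⟩
    rw [inner_fockVec_left, fockVec, lp.single_apply_ne _ _ _ hmn, inner_zero_right]
  dense_span := by
    exact (dense_span_fockVec dense_span_univ).mono
      (span_mono (Set.iUnion_mono fun n => Set.image_subset_range _ _))

variable (μ) in
lemma fockNumber_eq_diagonalOp : fockNumber μ = diagonalOp (particleVectors μ) fun n => n := by
  refine congrArg toLinearPMap (SetLike.ext fun p => forall_congr' fun n => ?_)
  rw [dGammaN_mulOne, isOrthogonalDecomposition_symTensor.graph_diagonalOp, mem_diagonalGraph]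
  simp only [particleVectors, Set.forall_mem_range, inner_fockVec_left, forall_const]

lemma fockVec_comp_equiv {m n : ℕ} (e : Fin m ≃ Fin n) (f : Fin n → L2 μ) :
    fockVec (f ∘ e) = fockVec f := by
  obtain rfl : m = n := Fin.equiv_iff_eq.1 ⟨e⟩
  refine congrArg (lp.single 2 m) (Subtype.ext (congrArg (_ • ·) ?_))
  exact Fintype.sum_equiv (Equiv.mulLeft e) _ _ fun τ => rfl

end Fock

section Splitting

lemma exists_sumCongr_eq {α β α' β' : Type*} (σ : α ⊕ β ≃ α' ⊕ β')
    (hl : ∀ a, (σ (Sum.inl a)).isLeft) (hr : ∀ b, (σ (Sum.inr b)).isRight) :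
    ∃ (e : α ≃ α') (e' : β ≃ β'), Equiv.sumCongr e e' = σ := by
  choose f hf using fun a => Sum.isLeft_iff.1 (hl a)
  choose g hg using fun b => Sum.isRight_iff.1 (hr b)
  have hmap : Sum.map f g = σ := by
    ext (a | b)
    exacts [(hf a).symm, (hg b).symm]
  obtain ⟨hf', hg'⟩ := Sum.map_bijective.1 (hmap ▸ σ.bijective)
  exact ⟨.ofBijective f hf', .ofBijective g hg', DFunLike.coe_injective hmap⟩

lemma sum_equiv_prod_eq_mul {R α β α' β' : Type*} [CommSemiring R] [Fintype α] [Fintype β]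
    [Fintype α'] [Fintype β'] [DecidableEq α] [DecidableEq β] [DecidableEq α'] [DecidableEq β']
    (M : α ⊕ β → α' ⊕ β' → R) (hlr : ∀ a b, M (Sum.inl a) (Sum.inr b) = 0)
    (hrl : ∀ b a, M (Sum.inr b) (Sum.inl a) = 0) :
    ∑ σ : α ⊕ β ≃ α' ⊕ β', ∏ i, M i (σ i) =
      (∑ e : α ≃ α', ∏ a, M (Sum.inl a) (Sum.inl (e a))) *
        ∑ e : β ≃ β', ∏ b, M (Sum.inr b) (Sum.inr (e b)) := by
  rw [Fintype.sum_mul_sum, ← Fintype.sum_prod_type']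
  refine (Fintype.sum_of_injective (fun p : (α ≃ α') × (β ≃ β') => Equiv.sumCongr p.1 p.2)
    ?_ _ _ (fun σ hσ => ?_) fun p => ?_).symm
  · exact fun p q h => Prod.ext
      (Equiv.ext fun a => Sum.inl_injective (Equiv.congr_fun h (Sum.inl a)))
      (Equiv.ext fun b => Sum.inr_injective (Equiv.congr_fun h (Sum.inr b)))
  · by_contra hne
    have hne' : ∀ i, M i (σ i) ≠ 0 := fun i h0 => hne (Finset.prod_eq_zero (Finset.mem_univ i) h0)
    obtain ⟨e, e', h⟩ := exists_sumCongr_eq σ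
      (fun a => by
        rcases h : σ (Sum.inl a) with x | y
        · rfl
        · exact absurd (hlr a y) (h ▸ hne' (Sum.inl a)))
      (fun b => by
        rcases h : σ (Sum.inr b) with x | y
        · exact absurd (hrl b x) (h ▸ hne' (Sum.inr b))
        · rfl)
    exact hσ ⟨(e, e'), h⟩
  · simp only [Fintype.prod_sum_type, Equiv.sumCongr_apply, Sum.map_inl, Sum.map_inr]

lemma exists_equiv_fin_add {n : ℕ} (p : Fin n → Prop) :
    ∃ (k m : ℕ) (e : Fin (k + m) ≃ Fin n),
      (∀ i, p (e (Fin.castAdd m i))) ∧ ∀ j, ¬ p (e (Fin.natAdd k j)) := by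
  classical
  let e₁ := (Fintype.equivFin {i // p i}).symm
  let e₂ := (Fintype.equivFin {i // ¬ p i}).symm
  refine ⟨_, _, finSumFinEquiv.symm.trans ((e₁.sumCongr e₂).trans (Equiv.sumCompl p)),
    fun i => ?_, fun j => ?_⟩
  · simpa using (e₁ i).2
  · simpa using (e₂ j).2

variable {X : Type*} [MeasurableSpace X] {μ : Measure X}

/-- `f` vanishes almost everywhere outside `s`, that is, `f` lies in the copy of `L²(s)` inside
`L²(X)`. -/
def VanishesOff (s : Set X) (f : L2 μ) : Prop := ∀ᵐ k ∂μ, k ∉ s → f k = 0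

lemma VanishesOff.mono {s t : Set X} {f : L2 μ} (hf : VanishesOff s f) (h : s ⊆ t) :
    VanishesOff t f := by
  filter_upwards [hf] with k hk hkt
  exact hk fun hks => hkt (h hks)

lemma inner_eq_zero_of_disjoint {s t : Set X} (h : Disjoint s t) {f g : L2 μ}
    (hf : VanishesOff s f) (hg : VanishesOff t g) : ⟪f, g⟫_ℂ = 0 := by
  rw [L2.inner_def]
  refine integral_eq_zero_of_ae ?_
  filter_upwards [hf, hg] with k hf hg
  by_cases hk : k ∈ s
  · rw [hg (Set.disjoint_left.1 h hk), inner_zero_right, Pi.zero_apply]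
  · rw [hf hk, inner_zero_left, Pi.zero_apply]

lemma inner_restrict {s : Set X} {f : L2 μ} (hf : VanishesOff s f) (g : L2 μ) :
    ⟪LpToLpRestrictCLM X ℂ ℂ μ 2 s f, LpToLpRestrictCLM X ℂ ℂ μ 2 s g⟫_ℂ = ⟪f, g⟫_ℂ := by
  rw [L2.inner_def, L2.inner_def,
    ← setIntegral_eq_integral_of_ae_compl_eq_zero (s := s) (f := fun k => ⟪f k, g k⟫_ℂ)]
  · refine integral_congr_ae ?_
    filter_upwards [LpToLpRestrictCLM_coeFn ℂ s f, LpToLpRestrictCLM_coeFn ℂ s g] with k hf hg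
    rw [hf, hg]
  · filter_upwards [hf] with k hk hks
    rw [hk hks, inner_zero_left]

lemma exists_vanishesOff_restrict_eq {s : Set X} (hs : MeasurableSet s) (h : L2 (μ.restrict s)) :
    ∃ f : L2 μ, VanishesOff s f ∧ LpToLpRestrictCLM X ℂ ℂ μ 2 s f = h := by
  have hmem : MemLp (s.indicator h) 2 μ := (memLp_indicator_iff_restrict hs).2 (Lp.memLp h)
  refine ⟨hmem.toLp _, ?_, Lp.ext ?_⟩
  · filter_upwards [hmem.coeFn_toLp] with k hk hks
    rw [hk, Set.indicator_of_notMem hks]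
  · filter_upwards [LpToLpRestrictCLM_coeFn ℂ s (hmem.toLp _),
      ae_restrict_of_ae hmem.coeFn_toLp, ae_restrict_mem hs] with k hrestrict hk hks
    rw [hrestrict, hk, Set.indicator_of_mem hks]

lemma ae_restrict_eq_zero_of_inner_vanishesOff {s : Set X} (hs : MeasurableSet s) {g : L2 μ}
    (hg : ∀ f : L2 μ, VanishesOff s f → ⟪f, g⟫_ℂ = 0) : g =ᵐ[μ.restrict s] 0 := by
  obtain ⟨f, hf, hfg⟩ := exists_vanishesOff_restrict_eq hs (LpToLpRestrictCLM X ℂ ℂ μ 2 s g)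
  have h := inner_restrict hf g
  rw [hg f hf, hfg, inner_self_eq_zero] at h
  exact (LpToLpRestrictCLM_coeFn ℂ s g).symm.trans ((Lp.eq_zero_iff_ae_eq_zero).1 h)

lemma dense_span_vanishesOff {ι : Type*} [Countable ι] {s : ι → Set X}
    (hs : ∀ i, MeasurableSet (s i)) (hcover : ∀ᵐ x ∂μ, ∃ i, x ∈ s i) :
    Dense (span ℂ {f : L2 μ | ∃ i, VanishesOff (s i) f} : Set (L2 μ)) := by
  rw [dense_iff_topologicalClosure_eq_top, topologicalClosure_eq_top_iff, eq_bot_iff]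
  intro g hg
  rw [mem_orthogonal_span_iff] at hg
  have hzero (i : ι) : ∀ᵐ x ∂μ, x ∈ s i → g x = 0 := (ae_restrict_iff' (hs i)).1
    (ae_restrict_eq_zero_of_inner_vanishesOff (hs i) fun f hf => hg f ⟨i, hf⟩)
  refine (Lp.eq_zero_iff_ae_eq_zero).2 ?_
  filter_upwards [ae_all_iff.2 hzero, hcover] with x hx ⟨i, hi⟩ using hx i hi

variable [SigmaFinite μ] {s t : Set X}

variable (μ s t) in
/-- The vectors `a†(f₁) ⋯ a†(fₖ) a†(g₁) ⋯ a†(gₘ) Ω` with `f₁, …, fₖ` supported in `s` and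
`g₁, …, gₘ` supported in `t`, for `(k, m)` the given pair of particle numbers. -/
def splitVectors (p : ℕ × ℕ) : Set (Fock μ) :=
  {ψ | ∃ (f : Fin p.1 → L2 μ) (g : Fin p.2 → L2 μ),
    (∀ i, VanishesOff s (f i)) ∧ (∀ j, VanishesOff t (g j)) ∧ ψ = fockVec (Fin.append f g)}

lemma splitVectors_subset_particleVectors (p : ℕ × ℕ) :
    splitVectors μ s t p ⊆ particleVectors μ (p.1 + p.2) := by
  rintro _ ⟨f, g, -, -, rfl⟩
  exact ⟨_, rfl⟩

lemma inner_fockVec_append (hst : Disjoint s t) {m n m' n' : ℕ}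
    {f : Fin m → L2 μ} {g : Fin n → L2 μ} {f' : Fin m' → L2 μ} {g' : Fin n' → L2 μ}
    (hf : ∀ i, VanishesOff s (f i)) (hg : ∀ i, VanishesOff t (g i))
    (hf' : ∀ i, VanishesOff s (f' i)) (hg' : ∀ i, VanishesOff t (g' i)) :
    ⟪fockVec (Fin.append f g), fockVec (Fin.append f' g')⟫_ℂ =
      ⟪fockVec f, fockVec f'⟫_ℂ * ⟪fockVec g, fockVec g'⟫_ℂ := by
  have happend {k l : ℕ} (u : Fin k → L2 μ) (v : Fin l → L2 μ) (i : Fin k ⊕ Fin l) :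
      Fin.append u v (finSumFinEquiv i) = Sum.elim u v i := by
    rcases i with i | i <;> simp
  have hblock := sum_equiv_prod_eq_mul (fun i j => ⟪Sum.elim f g i, Sum.elim f' g' j⟫_ℂ)
    (fun i j => inner_eq_zero_of_disjoint hst (hf i) (hg' j))
    (fun i j => inner_eq_zero_of_disjoint hst.symm (hg i) (hf' j))
  simp only [Sum.elim_inl, Sum.elim_inr] at hblock
  rw [inner_fockVec, inner_fockVec, inner_fockVec, ← hblock]
  refine (Fintype.sum_equiv (Equiv.equivCongr finSumFinEquiv finSumFinEquiv) _ _ fun σ => ?_).symm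
  refine Fintype.prod_equiv finSumFinEquiv _ _ fun i => ?_
  simp only [happend, Equiv.equivCongr_apply_apply, Equiv.symm_apply_apply]

lemma dense_span_splitVectors (hs : MeasurableSet s) (ht : MeasurableSet t)
    (hcover : ∀ᵐ k ∂μ, k ∈ s ∪ t) :
    Dense (span ℂ (⋃ p, splitVectors μ s t p) : Set (Fock μ)) := by
  have hdense := dense_span_vanishesOff (μ := μ) (s := fun b : Bool => cond b s t)
    (by simp [hs, ht]) (by simpa [or_comm] using hcover)
  refine (dense_span_fockVec hdense).mono (span_mono (Set.iUnion_subset fun n => ?_))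
  rintro _ ⟨f, hf, rfl⟩
  obtain ⟨k, m, e, hk, hm⟩ := exists_equiv_fin_add fun i => VanishesOff s (f i)
  refine Set.mem_iUnion_of_mem (k, m) ⟨_, fun j => f (e (Fin.natAdd k j)), hk, fun j => ?_, ?_⟩
  · obtain ⟨_ | _, h⟩ := hf (e (Fin.natAdd k j))
    exacts [h, absurd h (hm j)]
  · rw [← fockVec_comp_equiv e f]
    exact congrArg fockVec Fin.append_castAdd_natAdd.symm

lemma isOrthogonalDecomposition_splitVectors (hs : MeasurableSet s) (ht : MeasurableSet t)
    (hst : Disjoint s t) (hcover : ∀ᵐ k ∂μ, k ∈ s ∪ t) :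
    IsOrthogonalDecomposition (splitVectors μ s t) where
  inner_eq_zero := by
    rintro p q hpq _ ⟨f, g, hf, hg, rfl⟩ _ ⟨f', g', hf', hg', rfl⟩
    have horth := (isOrthogonalDecomposition_particleVectors μ).inner_eq_zero
    rw [inner_fockVec_append hst hf hg hf' hg', mul_eq_zero]
    refine (Classical.em (p.1 = q.1)).symm.imp (fun h => ?_) fun h => ?_
    · exact horth h _ ⟨f, rfl⟩ _ ⟨f', rfl⟩
    · exact horth (fun h' => hpq (Prod.ext h h')) _ ⟨g, rfl⟩ _ ⟨g', rfl⟩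
  dense_span := dense_span_splitVectors hs ht hcover

end Splitting

section SplitNumber

variable {X : Type*} [MeasurableSpace X] {μ : Measure X} [SigmaFinite μ] {s t : Set X}
variable (H : Type*) [NormedAddCommGroup H] [InnerProductSpace ℂ H]

lemma exists_linearIsometryEquiv_fockSplit (hs : MeasurableSet s) (ht : MeasurableSet t)
    (hst : Disjoint s t) (hcover : ∀ᵐ k ∂μ, k ∈ s ∪ t) :
    ∃ V : Fock μ ≃ₗᵢ[ℂ] HilbertTensor (Fock (μ.restrict s)) (Fock (μ.restrict t)),
      (∀ p, ∀ ψ ∈ splitVectors μ s t p,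
        V ψ ∈ Set.image2 elemTensor Set.univ (particleVectors (μ.restrict t) p.2)) ∧
      fockSplit μ s t = (V : Fock μ →ₗ[ℂ]
        HilbertTensor (Fock (μ.restrict s)) (Fock (μ.restrict t))).toPMap ⊤ := by
  have dense_particle (ν : Measure X) [SigmaFinite ν] :=
    (isOrthogonalDecomposition_particleVectors ν).dense_span
  obtain ⟨V, hV, hsplit⟩ := exists_linearIsometryEquiv_of_gram
    (R := {p : Fock μ × HilbertTensor (Fock (μ.restrict s)) (Fock (μ.restrict t)) |
      ∃ (m n : ℕ) (f : Fin m → L2 μ) (g : Fin n → L2 μ),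
        (∀ i, VanishesOff s (f i)) ∧ (∀ j, VanishesOff t (g j)) ∧
        p = (fockVec (Fin.append f g),
          elemTensor (fockVec fun i => LpToLpRestrictCLM X ℂ ℂ μ 2 s (f i))
            (fockVec fun j => LpToLpRestrictCLM X ℂ ℂ μ 2 t (g j)))})
    (by
      rintro _ ⟨m, n, f, g, hf, hg, rfl⟩ _ ⟨m', n', f', g', hf', hg', rfl⟩
      rw [inner_fockVec_append hst hf hg hf' hg', inner_elemTensor]
      simp only [inner_fockVec, inner_restrict (hf _), inner_restrict (hg _)])
    ((dense_span_splitVectors hs ht hcover).mono <| span_mono <| by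
      rintro _ ⟨_, ⟨p, rfl⟩, f, g, hf, hg, rfl⟩
      exact ⟨_, ⟨p.1, p.2, f, g, hf, hg, rfl⟩, rfl⟩)
    ((dense_span_image2_elemTensor (dense_particle (μ.restrict s))
      (dense_particle (μ.restrict t))).mono <| span_mono <| by
      rintro _ ⟨_, ⟨_, ⟨m, rfl⟩, f, rfl⟩, _, ⟨_, ⟨n, rfl⟩, g, rfl⟩, rfl⟩
      choose f' hf' hff' using fun i => exists_vanishesOff_restrict_eq hs (f i)
      choose g' hg' hgg' using fun j => exists_vanishesOff_restrict_eq ht (g j)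
      refine ⟨_, ⟨m, n, f', g', hf', hg', rfl⟩, ?_⟩
      simp only [hff', hgg'])
  refine ⟨V, ?_, hsplit⟩
  rintro p _ ⟨f, g, hf, hg, rfl⟩
  exact (hV _ ⟨p.1, p.2, f, g, hf, hg, rfl⟩) ▸ ⟨_, trivial, _, ⟨_, rfl⟩, rfl⟩

variable (μ s t) in
/-- The vectors `x ⊗ a†(f₁) ⋯ a†(fₖ) a†(g₁) ⋯ a†(gₘ) Ω` of `𝓗 ⊗ 𝓕_b(L²(X))`, on which both number
operators act by a scalar: the total number is `k + m`, the number of particles in `t` is `m`. -/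
abbrev stateVectors (p : ℕ × ℕ) : Set (HilbertTensor H (Fock μ)) :=
  Set.image2 elemTensor Set.univ (splitVectors μ s t p)

/-- The operator `U* (I ⊗ I ⊗ dΓ_t(1)) U` on `𝓗 ⊗ 𝓕_b(L²(X))` counting the particles in `t`, where
`U` splits the Fock space into the Fock spaces over `L²(s)` and `L²(t)`. -/
def restrictedNumber (μ : Measure X) [SigmaFinite μ] (s t : Set X) :
    HilbertTensor H (Fock μ) →ₗ.[ℂ] HilbertTensor H (Fock μ) :=
  conjBy (idTensor H (fockSplit μ s t))
    (idTensor H (idTensor (Fock (μ.restrict s)) (fockNumber (μ.restrict t))))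

lemma idTensor_fockNumber_eq_diagonalOp (hs : MeasurableSet s) (ht : MeasurableSet t)
    (hst : Disjoint s t) (hcover : ∀ᵐ k ∂μ, k ∈ s ∪ t) :
    idTensor H (fockNumber μ) =
      diagonalOp (stateVectors μ s t H) fun p => ((p.1 + p.2 : ℕ) : ℝ) := by
  have hsplit := isOrthogonalDecomposition_splitVectors hs ht hst hcover
  have hparticle := isOrthogonalDecomposition_particleVectors μ
  rw [fockNumber_eq_diagonalOp, hparticle.diagonalOp_eq_of_subset hsplit
    splitVectors_subset_particleVectors, hsplit.idTensor_diagonalOp]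
  rfl

lemma restrictedNumber_eq_diagonalOp (hs : MeasurableSet s) (ht : MeasurableSet t)
    (hst : Disjoint s t) (hcover : ∀ᵐ k ∂μ, k ∈ s ∪ t) :
    restrictedNumber H μ s t = diagonalOp (stateVectors μ s t H) fun p => (p.2 : ℝ) := by
  obtain ⟨V, hVψ, hV⟩ := exists_linearIsometryEquiv_fockSplit hs ht hst hcover
  rw [restrictedNumber, hV, fockNumber_eq_diagonalOp]
  exact conjBy_idTensor_diagonalOp H (isOrthogonalDecomposition_splitVectors hs ht hst hcover)
    (isOrthogonalDecomposition_particleVectors (μ.restrict t)) V hVψ fun n => (n : ℝ)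

end SplitNumber

section Exhaustion

variable {X : Type*} [MeasurableSpace X] {μ : Measure X} [SigmaFinite μ]
variable {H : Type*} [NormedAddCommGroup H] [InnerProductSpace ℂ H]

lemma extNormSq_opSqrt_restrictedNumber_le {s t : Set X} (hs : MeasurableSet s)
    (ht : MeasurableSet t) (hst : Disjoint s t) (hcover : ∀ᵐ k ∂μ, k ∈ s ∪ t)
    (Ψ : HilbertTensor H (Fock μ)) :
    extNormSq (opSqrt (restrictedNumber H μ s t)) Ψ ≤
      extNormSq (opSqrt (idTensor H (fockNumber μ))) Ψ := by
  have hstate := (isOrthogonalDecomposition_splitVectors hs ht hst hcover).idTensor (E := H)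
  rw [restrictedNumber_eq_diagonalOp H hs ht hst hcover,
    idTensor_fockNumber_eq_diagonalOp H hs ht hst hcover,
    extNormSq_opSqrt_diagonalOp hstate fun _ => Nat.cast_nonneg _,
    extNormSq_opSqrt_diagonalOp hstate fun _ => Nat.cast_nonneg _]
  gcongr with p
  exact Nat.le_add_left _ _

lemma splitVectors_zero_left (s t : Set X) (n : ℕ) : splitVectors μ s t (0, n) =
    fockVec '' {g : Fin n → L2 μ | ∀ j, VanishesOff t (g j)} := by
  have happend (f : Fin 0 → L2 μ) (g : Fin n → L2 μ) : fockVec (Fin.append f g) = fockVec g := by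
    rw [Subsingleton.elim f Fin.elim0, Fin.elim0_append]
    exact fockVec_comp_equiv (finCongr n.zero_add) g
  ext ψ
  constructor
  · rintro ⟨f, g, -, hg, rfl⟩
    exact ⟨g, hg, (happend f g).symm⟩
  · rintro ⟨g, hg, rfl⟩
    exact ⟨Fin.elim0, g, fun i => i.elim0, hg, (happend _ g).symm⟩

lemma elemTensor_mem_of_monotone {t : ℕ → Set X} (ht : ∀ k, MeasurableSet (t k))
    (hmono : Monotone t) (hexhaust : ∀ᵐ x ∂μ, ∃ k, x ∈ t k) {n : ℕ}
    {K : Submodule ℂ (HilbertTensor H (Fock μ))}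
    (hK : IsClosed (K : Set (HilbertTensor H (Fock μ))))
    (h : ∀ k x (g : Fin n → L2 μ), (∀ j, VanishesOff (t k) (g j)) → elemTensor x (fockVec g) ∈ K)
    (x : H) (f : Fin n → L2 μ) : elemTensor x (fockVec f) ∈ K := by
  let A : symPow μ n →L[ℂ] HilbertTensor H (Fock μ) :=
    (elemTensorLeft x).comp (lp.singleContinuousLinearMap ℂ (fun n : ℕ => symPow μ n) 2 n)
  refine mem_of_dense_span (K := K.comap A.toLinearMap)
    (dense_span_symTensor (dense_span_vanishesOff ht hexhaust)) (hK.preimage A.continuous) ?_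
    (symTensor f)
  rintro _ ⟨g, hg, rfl⟩
  choose κ hκ using hg
  exact h (Finset.univ.sup κ) x g fun j =>
    (hκ j).mono (hmono (Finset.le_sup (Finset.mem_univ j)))

lemma tendsto_component_zero_left {s t : ℕ → Set X} (ht : ∀ k, MeasurableSet (t k))
    (hmono : Monotone t) (hexhaust : ∀ᵐ x ∂μ, ∃ k, x ∈ t k) (n : ℕ)
    (Ψ : HilbertTensor H (Fock μ)) :
    Tendsto (fun k => component (stateVectors μ (s k) (t k) H) (0, n) Ψ) atTop
      (𝓝 (component (fun n => Set.image2 elemTensor Set.univ (particleVectors μ n)) n Ψ)) := by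
  let A (k : ℕ) : Submodule ℂ (HilbertTensor H (Fock μ)) :=
    summand (stateVectors μ (s k) (t k) H) (0, n)
  have hA : Monotone A := fun k l hkl => by
    refine topologicalClosure_mono (span_mono (Set.image2_subset_left ?_))
    rw [splitVectors_zero_left, splitVectors_zero_left]
    exact Set.image_mono fun g hg j => (hg j).mono (hmono hkl)
  have hclosure : (⨆ k, A k).topologicalClosure =
      summand (fun n => Set.image2 elemTensor Set.univ (particleVectors μ n)) n := by
    refine le_antisymm (topologicalClosure_minimal _ (iSup_le fun k => ?_)
      (isClosed_topologicalClosure _)) (topologicalClosure_minimal _ (span_le.2 ?_)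
      (isClosed_topologicalClosure _))
    · refine topologicalClosure_mono (span_mono (Set.image2_subset_left ?_))
      exact (splitVectors_subset_particleVectors (0, n)).trans (by rw [Nat.zero_add])
    · rintro _ ⟨x, -, _, ⟨f, rfl⟩, rfl⟩
      refine elemTensor_mem_of_monotone ht hmono hexhaust (isClosed_topologicalClosure _)
        (fun k x g hg => le_topologicalClosure _ (mem_iSup_of_mem k ?_)) x f
      refine subset_summand _ _ ⟨x, trivial, _, ?_, rfl⟩
      rw [splitVectors_zero_left]
      exact ⟨g, hg, rfl⟩
  have := starProjection_tendsto_closure_iSup A hA Ψ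
  simp only [hclosure] at this
  exact this

lemma extNormSq_opSqrt_idTensor_fockNumber_le {s t : ℕ → Set X} (hs : ∀ k, MeasurableSet (s k))
    (ht : ∀ k, MeasurableSet (t k)) (hst : ∀ k, Disjoint (s k) (t k))
    (hcover : ∀ k, ∀ᵐ x ∂μ, x ∈ s k ∪ t k) (hmono : Monotone t)
    (hexhaust : ∀ᵐ x ∂μ, ∃ k, x ∈ t k) (Ψ : HilbertTensor H (Fock μ)) :
    extNormSq (opSqrt (idTensor H (fockNumber μ))) Ψ ≤
      ⨆ k, extNormSq (opSqrt (restrictedNumber H μ (s k) (t k))) Ψ := by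
  have hparticle := isOrthogonalDecomposition_particleVectors μ
  rw [fockNumber_eq_diagonalOp, hparticle.idTensor_diagonalOp, extNormSq_opSqrt_diagonalOp
    (hparticle.idTensor (E := H)) fun _ => Nat.cast_nonneg _, ENNReal.tsum_eq_iSup_sum]
  refine iSup_le fun F => ?_
  have hlim := tendsto_finsetSum F fun n _ => ENNReal.Tendsto.const_mul
    (ENNReal.Tendsto.pow (n := 2)
      (tendsto_component_zero_left (s := s) ht hmono hexhaust n Ψ).enorm)
    (Or.inr (ENNReal.ofReal_ne_top (r := n)))
  refine le_of_tendsto hlim (Eventually.of_forall fun k => ?_)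
  refine le_iSup_of_le k ?_
  have hstate := (isOrthogonalDecomposition_splitVectors (hs k) (ht k) (hst k)
    (hcover k)).idTensor (E := H)
  rw [restrictedNumber_eq_diagonalOp H (hs k) (ht k) (hst k) (hcover k),
    extNormSq_opSqrt_diagonalOp hstate fun _ => Nat.cast_nonneg _]
  exact (ENNReal.sum_le_tsum F).trans
    (ENNReal.tsum_comp_le_tsum_of_injective (Prod.mk_right_injective 0) _)

end Exhaustion

section Euclidean

variable {d : ℕ}

lemma measurableSet_inner_set (ε : ℝ) : MeasurableSet (inner_set d ε) :=
  measurableSet_lt measurable_norm measurable_const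

lemma measurableSet_outer_set (ε : ℝ) : MeasurableSet (outer_set d ε) :=
  measurableSet_lt measurable_const measurable_norm

lemma disjoint_inner_outer (ε : ℝ) : Disjoint (inner_set d ε) (outer_set d ε) :=
  Set.disjoint_left.2 fun k (h₁ : ‖k‖ < ε) (h₂ : ε < ‖k‖) => h₁.not_gt h₂

lemma antitone_outer_set : Antitone (outer_set d) := fun _ _ hεδ _ hk => hεδ.trans_lt hk

lemma ae_mem_inner_union_outer {ε : ℝ} (hε : 0 < ε) :
    ∀ᵐ k ∂leb d, k ∈ inner_set d ε ∪ outer_set d ε := by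
  filter_upwards [measure_eq_zero_iff_ae_notMem.1
    (Measure.addHaar_sphere_of_ne_zero (leb d) 0 hε.ne')] with k hk
  exact lt_or_gt_of_ne fun h => hk (mem_sphere_zero_iff_norm.2 h)

lemma ae_exists_mem_outer_set (hd : 1 ≤ d) :
    ∀ᵐ k ∂leb d, ∃ n : ℕ, k ∈ outer_set d (1 / (n + 1)) := by
  have : Nonempty (Fin d) := ⟨⟨0, hd⟩⟩
  filter_upwards [measure_eq_zero_iff_ae_notMem.1 (measure_singleton (μ := leb d) 0)] with k hk
  exact exists_nat_one_div_lt (norm_pos_iff.2 hk)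

lemma iSup_extNormSq_opSqrt_numberGT {H : Type*} [NormedAddCommGroup H] [InnerProductSpace ℂ H]
    (hd : 1 ≤ d) (Ψ : StateSpace H d) :
    ⨆ ε : Set.Ioi (0 : ℝ), extNormSq (opSqrt (numberGT H d ε)) Ψ =
      extNormSq (opSqrt (number H d)) Ψ := by
  refine le_antisymm (iSup_le fun ε => extNormSq_opSqrt_restrictedNumber_le
    (measurableSet_inner_set _) (measurableSet_outer_set _) (disjoint_inner_outer _)
    (ae_mem_inner_union_outer ε.2) Ψ) ?_
  have hε (n : ℕ) : (0 : ℝ) < 1 / (n + 1) := Nat.one_div_pos_of_nat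
  calc extNormSq (opSqrt (number H d)) Ψ
      ≤ ⨆ n : ℕ, extNormSq (opSqrt (numberGT H d (1 / (n + 1)))) Ψ :=
        extNormSq_opSqrt_idTensor_fockNumber_le (fun _ => measurableSet_inner_set _)
          (fun _ => measurableSet_outer_set _) (fun _ => disjoint_inner_outer _)
          (fun n => ae_mem_inner_union_outer (hε n))
          (antitone_outer_set.comp fun _ _ => Nat.one_div_le_one_div)
          (ae_exists_mem_outer_set hd) Ψ
    _ ≤ ⨆ ε : Set.Ioi (0 : ℝ), extNormSq (opSqrt (numberGT H d ε)) Ψ :=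
        iSup_comp_le (fun ε : Set.Ioi (0 : ℝ) => extNormSq (opSqrt (numberGT H d ε)) Ψ)
          fun n => ⟨_, hε n⟩

end Euclidean

end FockNumber

end

theorem mainTheorem12_general (H : Type*) [NormedAddCommGroup H] [InnerProductSpace ℂ H]
    (d : ℕ) (hd : 1 ≤ d) :
    FockNumber.domainCNB H d =
        ((FockNumber.opSqrt (FockNumber.number H d)).domain :
          Set (FockNumber.StateSpace H d)) ∧
      ∀ Ψ : FockNumber.StateSpace H d, Ψ ∈ FockNumber.domainCNB H d →
        ∃ (h : ∀ ε : ℝ, 0 < ε → Ψ ∈ (FockNumber.opSqrt (FockNumber.numberGT H d ε)).domain)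
          (h₀ : Ψ ∈ (FockNumber.opSqrt (FockNumber.number H d)).domain),
          IsLUB
            (Set.range fun ε : Set.Ioi (0 : ℝ) =>
              ‖FockNumber.opSqrt (FockNumber.numberGT H d ε) ⟨Ψ, h ε ε.2⟩‖ ^ 2)
            (‖FockNumber.opSqrt (FockNumber.number H d) ⟨Ψ, h₀⟩‖ ^ 2) := by
  have hsup := FockNumber.iSup_extNormSq_opSqrt_numberGT (H := H) hd
  have hdomain (Ψ : FockNumber.StateSpace H d) : Ψ ∈ FockNumber.domainCNB H d ↔
      Ψ ∈ (FockNumber.opSqrt (FockNumber.number H d)).domain := by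
    rw [FockNumber.mem_domain_iff_of_iSup_extNormSq (hsup Ψ)]
    exact ⟨fun ⟨h, hbdd⟩ => ⟨fun ε => h ε ε.2, hbdd⟩,
      fun ⟨h, hbdd⟩ => ⟨fun ε hε => h ⟨ε, hε⟩, hbdd⟩⟩
  exact ⟨Set.ext hdomain, fun Ψ hΨ => ⟨hΨ.1, (hdomain Ψ).1 hΨ,
    FockNumber.isLUB_norm_sq_of_iSup_extNormSq (hsup Ψ) _ fun ε => hΨ.1 ε ε.2⟩⟩

theorem mainTheorem12 (H : Type*) [NormedAddCommGroup H] [InnerProductSpace ℂ H]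
    [CompleteSpace H] [TopologicalSpace.SeparableSpace H] (d : ℕ) (hd : 1 ≤ d) :
    FockNumber.domainCNB H d =
        ((FockNumber.opSqrt (FockNumber.number H d)).domain :
          Set (FockNumber.StateSpace H d)) ∧
      ∀ Ψ : FockNumber.StateSpace H d, Ψ ∈ FockNumber.domainCNB H d →
        ∃ (h : ∀ ε : ℝ, 0 < ε → Ψ ∈ (FockNumber.opSqrt (FockNumber.numberGT H d ε)).domain)
          (h₀ : Ψ ∈ (FockNumber.opSqrt (FockNumber.number H d)).domain),
          IsLUB
            (Set.range fun ε : Set.Ioi (0 : ℝ) =>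
              ‖FockNumber.opSqrt (FockNumber.numberGT H d ε) ⟨Ψ, h ε ε.2⟩‖ ^ 2)
            (‖FockNumber.opSqrt (FockNumber.number H d) ⟨Ψ, h₀⟩‖ ^ 2) :=
  mainTheorem12_general H d hd
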